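/- Let $\hbar>0$, $n_A,n_B\ge 0$, $n=n_A+n_B$, and write points of the phase space $\mathbb{R}^{2n}$ as $z=(z_A,z_B)$ with $z_A=(x_A,p_A)\in\mathbb{R}^{2n_A}$, $z_B=(x_B,p_B)\in\mathbb{R}^{2n_B}$; put $J_A=\begin{pmatrix}0&I\\-I&0\end{pmatrix}$ (blocks of size $n_A$), $J_B$ likewise, and $J=J_A\oplus J_B$. The Wigner distribution of a density operator $\hat\rho$ (a positive operator of trace one) on $L^2(\mathbb{R}^n)$ is $$\rho(x,p)=\Big(\frac1{2\pi\hbar}\Big)^{n}\int_{\mathbb{R}^n}e^{-\frac{i}{\hbar}p\cdot y}\,\langle x+\tfrac12y|\hat\rho|x-\tfrac12y\rangle\,dy=\sum_j\lambda_jW\psi_j(x,p),$$ where $\hat\rho=\sum_j\lambda_j|\psi_j\rangle\langle\psi_j|$ is a spectral decomposition and $W\psi(x,p)=(2\pi\hbar)^{-n}\int e^{-\frac{i}{\hbar}p\cdot y}\psi(x+\frac12y)\overline{\psi(x-\frac12y)}\,dy$. The operator $\hat\rho$ is called the centered Gaussian state with covariance matrix $\Sigma$, where $\Sigma$ is a real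 symmetric positive definite $2n\times2n$ matrix with $\Sigma+\frac{i\hbar}2J\ge0$, if $$\rho(z)=\frac{1}{(2\pi)^n\sqrt{\det\Sigma}}\,e^{-\frac12z^T\Sigma^{-1}z}\qquad\text{for all } z\in\mathbb{R}^{2n};$$ the same definitions are used on $L^2(\mathbb{R}^{n_A})$. Let $\hat\rho$ be the centered Gaussian state on $L^2(\mathbb{R}^n)$ with covariance matrix $$\Sigma=\begin{pmatrix}\Sigma_{AA}&\Sigma_{AB}\\ \Sigma_{AB}^T&\Sigma_{BB}\end{pmatrix}$$ (blocks according to $z=(z_A,z_B)$). Then there is exactly one trace class operator $\hat\rho^A=\operatorname{Tr}^B(\hat\rho)$ on $L^2(\mathbb{R}^{n_A})$ with $\operatorname{Tr}(\hat\rho(\hat Q\otimes \hat I^B))=\operatorname{Tr}(\hat\rho^A\hat Q)$ for all bounded operators $\hat Q$ on $L^2(\mathbb{R}^{n_A})$ (the reduced state), and: 1. $\hat\rho^A$ is the centered Gaussian state with covariance matrix $\Sigma_{AA}$; that is, it is a density operator, $\Sigma_{AA}$ is symmetric positive definite with $\Sigma_{AA}+\frac{i\hbar}2J_A\ge0$,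 and its Wigner distribution is $$\rho^A(z_A)=\frac{1}{(2\pi)^{n_A}\sqrt{\det\Sigma_{AA}}}\,e^{-\frac12z_A^T\Sigma_{AA}^{-1}z_A}.$$ 2. Its purity is $\operatorname{Tr}[(\hat\rho^A)^2]=\left(\frac\hbar2\right)^{n_A}(\det\Sigma_{AA})^{-1/2}$. 3. $\hat\rho^A$ is pure (that is, $\hat\rho^A=|\psi\rangle\langle\psi|$ for some unit vector $\psi\in L^2(\mathbb{R}^{n_A})$) if and only if $\det\Sigma_{AA}=(\hbar/2)^{2n_A}$, and if and only if $\Sigma_{AA}=\frac\hbar2S_A^TS_A$ for some real $2n_A\times2n_A$ matrix $S_A$ with $S_A^TJ_AS_A=J_A$. -/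

import Mathlib

open MeasureTheory
open scoped ComplexConjugate ComplexOrder InnerProductSpace

/-- The Hilbert space `L²(ℝ^ι)` of complex square-integrable functions for Lebesgue measure. -/
abbrev L2 (ι : Type) [Fintype ι] : Type := Lp ℂ 2 (volume : Measure (ι → ℝ))

section Trace

variable {H : Type} [NormedAddCommGroup H] [InnerProductSpace ℂ H] [CompleteSpace H]

/-- `T` is of trace class: `∑ ⟨b i, |T| b i⟩` converges in orthonormal bases, `|T| = (T* T)^(1/2)`. -/
def IsTraceClass (T : H →L[ℂ] H) : Prop :=
  ∀ (J : Type) (b : HilbertBasis J ℂ H), Summable fun j => ⟪b j, CFC.abs T (b j)⟫_ℂ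

/-- `Tr T = t`: the series `∑ ⟨b i, T b i⟩` converges to `t` in every orthonormal basis. -/
def HasTrace (T : H →L[ℂ] H) (t : ℂ) : Prop :=
  ∀ (J : Type) (b : HilbertBasis J ℂ H), HasSum (fun j => ⟪b j, T (b j)⟫_ℂ) t

/-- Density operators: positive semidefinite, of trace class, of trace one. -/
structure IsDensityOperator (T : H →L[ℂ] H) : Prop where
  positive : T.IsPositive
  traceClass : IsTraceClass T
  trace_one : HasTrace T 1

/-- `T` is a pure state `|ψ⟩⟨ψ|` with `ψ` a unit vector. -/
def IsPureState (T : H →L[ℂ] H) : Prop :=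
  ∃ ψ : H, ‖ψ‖ = 1 ∧ ∀ f : H, T f = ⟪ψ, f⟫_ℂ • ψ

end Trace

section PartialTrace

variable {α β : Type} [Fintype α] [Fintype β]

theorem memLp_tensor (φ : L2 α) (ψ : L2 β) :
    MemLp (fun x : α ⊕ β → ℝ => φ (fun i => x (Sum.inl i)) * ψ (fun i => x (Sum.inr i))) 2
      volume := by
  have hmp : MeasurePreserving (MeasurableEquiv.sumPiEquivProdPi fun _ : α ⊕ β => ℝ)
      volume volume := volume_measurePreserving_sumPiEquivProdPi fun _ => ℝ
  have hφ := Lp.memLp φ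
  have hψ := Lp.memLp ψ
  have hm : AEStronglyMeasurable (fun z : (α → ℝ) × (β → ℝ) => φ z.1 * ψ z.2)
      (volume.prod volume) := hφ.1.comp_fst.mul hψ.1.comp_snd
  have h : MemLp (fun z : (α → ℝ) × (β → ℝ) => φ z.1 * ψ z.2) 2 (volume.prod volume) := by
    rw [memLp_two_iff_integrable_sq_norm hm]
    have h1 := (memLp_two_iff_integrable_sq_norm hφ.1).1 hφ
    have h2 := (memLp_two_iff_integrable_sq_norm hψ.1).1 hψ
    simpa [mul_pow] using h1.mul_prod h2
  exact h.comp_measurePreserving hmp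

/-- The tensor product `φ ⊗ ψ`, that is, `(x_A, x_B) ↦ φ(x_A) ψ(x_B)`. -/
noncomputable def tensor (φ : L2 α) (ψ : L2 β) : L2 (α ⊕ β) :=
  (memLp_tensor φ ψ).toLp _

/-- `R` is the bounded operator `Q ⊗ I`: it sends `φ ⊗ ψ` to `(Q φ) ⊗ ψ`. Since the tensors
`φ ⊗ ψ` span a dense subspace, `R` is determined by `Q`. -/
def IsTensorId (Q : L2 α →L[ℂ] L2 α) (R : L2 (α ⊕ β) →L[ℂ] L2 (α ⊕ β)) : Prop :=
  ∀ (φ : L2 α) (ψ : L2 β), R (tensor φ ψ) = tensor (Q φ) ψ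

/-- `ρA = Tr^B ρ`: the operator `ρA` is of trace class and
`Tr (ρ (Q ⊗ I)) = Tr (ρA Q)` for all bounded operators `Q`. -/
def IsPartialTrace (ρ : L2 (α ⊕ β) →L[ℂ] L2 (α ⊕ β)) (ρA : L2 α →L[ℂ] L2 α) : Prop :=
  IsTraceClass ρA ∧
    ∀ (Q : L2 α →L[ℂ] L2 α) (R : L2 (α ⊕ β) →L[ℂ] L2 (α ⊕ β)), IsTensorId Q R →
      ∃ t : ℂ, HasTrace (ρ ∘L R) t ∧ HasTrace (ρA ∘L Q) t

end PartialTrace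

section Gaussian

variable {ι : Type} [Fintype ι]

/-- The cross-Wigner transform `W(φ, ψ)(x, p)`. A point of phase space is `z : ι ⊕ ι → ℝ`, with
positions `x i = z (inl i)` and momenta `p i = z (inr i)`. -/
noncomputable def crossWigner (ħ : ℝ) (φ ψ : L2 ι) (z : ι ⊕ ι → ℝ) : ℂ :=
  let x : ι → ℝ := fun i => z (Sum.inl i)
  let p : ι → ℝ := fun i => z (Sum.inr i)
  (((1 / (2 * Real.pi * ħ)) ^ Fintype.card ι : ℝ) : ℂ) *
    ∫ y : ι → ℝ, Complex.exp (-(Complex.I / (ħ : ℂ)) * ((p ⬝ᵥ y : ℝ) : ℂ)) *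
      φ (x + (1 / 2 : ℝ) • y) * conj (ψ (x - (1 / 2 : ℝ) • y))

/-- `w` is the Wigner distribution of the trace class operator `T`,
`w(x,p) = (2πħ)^(-n) ∫ e^(-ipy/ħ) ⟨x + y/2| T |x - y/2⟩ dy`.
The kernel is `⟨x|T|x'⟩ = ∑ (T b_j)(x) conj (b_j(x'))` for an orthonormal basis `b`, hence
`w = ∑ W(T b_j, b_j)`; for `T = ∑ λ_j |ψ_j⟩⟨ψ_j|` in a basis of eigenvectors this is
`∑ λ_j W ψ_j`. -/
def IsWignerDistribution (ħ : ℝ) (T : L2 ι →L[ℂ] L2 ι) (w : (ι ⊕ ι → ℝ) → ℂ) : Prop :=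
  ∀ (J : Type) (b : HilbertBasis J ℂ (L2 ι)) (z : ι ⊕ ι → ℝ),
    HasSum (fun j => crossWigner ħ (T (b j)) (b j) z) (w z)

variable [DecidableEq ι]

/-- The centered Gaussian probability density on the phase space `ℝ^(2n)` with covariance `Σ`. -/
noncomputable def gaussianDensity (S : Matrix (ι ⊕ ι) (ι ⊕ ι) ℝ) (z : ι ⊕ ι → ℝ) : ℝ :=
  1 / ((2 * Real.pi) ^ Fintype.card ι * Real.sqrt S.det) *
    Real.exp (-(1 / 2) * (z ⬝ᵥ S⁻¹.mulVec z))

/-- The standard symplectic matrix with blocks `0, I, -I, 0`. -/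
def stdJ (ι : Type) [DecidableEq ι] (R : Type) [Ring R] : Matrix (ι ⊕ ι) (ι ⊕ ι) R :=
  Matrix.fromBlocks 0 1 (-1) 0

/-- `T` is the centered Gaussian state with covariance matrix `S`: a density operator whose
Wigner distribution is the Gaussian density of covariance `S`, where `S` is symmetric positive
definite and satisfies the uncertainty principle `S + (iħ/2) J ≥ 0`. -/
structure IsGaussianState (ħ : ℝ) (T : L2 ι →L[ℂ] L2 ι) (S : Matrix (ι ⊕ ι) (ι ⊕ ι) ℝ) :
    Prop where
  density : IsDensityOperator T
  posDef : S.PosDef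
  uncertainty : (S.map (fun a : ℝ => (a : ℂ)) +
    (Complex.I * (ħ : ℂ) / 2) • stdJ ι ℂ).PosSemidef
  wigner : IsWignerDistribution ħ T fun z => ((gaussianDensity S z : ℝ) : ℂ)

/-- A matrix in the splitting `z = (z_A, z_B)`, `z_A = (x_A, p_A)`, `z_B = (x_B, p_B)` of phase
space, rewritten in the coordinates `z = (x, p)`, `x = (x_A, x_B)`, `p = (p_A, p_B)`. It takes
`J_A ⊕ J_B` to `J`. -/
def toPositionMomentum {α β : Type} (M : Matrix ((α ⊕ α) ⊕ (β ⊕ β)) ((α ⊕ α) ⊕ (β ⊕ β)) ℝ) :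
    Matrix ((α ⊕ β) ⊕ (α ⊕ β)) ((α ⊕ β) ⊕ (α ⊕ β)) ℝ :=
  M.submatrix (Equiv.sumSumSumComm α β α β) (Equiv.sumSumSumComm α β α β)

end Gaussian

/-! The argument rests on the Grossmann–Royer reflections `royer ħ z`. These norm-preserving
operators satisfy `W(φ, ψ)(z) = (πħ)^(-n) ⟪ψ, royer ħ z φ⟫` (`crossWigner_eq_inner`), so the Wigner
distribution of a density operator `T` is `(πħ)^(-n) Tr (T ∘ royer ħ z)`. Statements on Wigner
functions thus become statements on traces against bounded operators. Traces are handled by writing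
`T = S S` with `S` self-adjoint and Hilbert–Schmidt, which makes every series absolutely convergent
and every trace independent of the basis.

The reduced state is `M† M`, where `M φ` is the family `S (φ ⊗ c k)` for a basis `c` of the second
factor. It is unique because rank one test operators detect all matrix elements. The reflection at
`z` in the first factor is itself a test operator, so the Wigner function of the reduced state is
governed by `Tr (ρ (R(z) ⊗ I))`. Formally `∫ R(w) dw = (πħ)^(n_B) I`, which would make this the
marginal over `w`, but that integral does not converge absolutely. It is regularized by normalized
coherent states `h_w`: the projection on `h_w` is an absolutely convergent Gaussian average of
reflections, and `∫ |h_w⟩⟨h_w| dw = (2π)^(n_B) I`. Exchanging the two integrals gives the marginal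
(`hasTrace_comp_royer_tensorId`). A Schur complement then shows that the marginal of the Gaussian
has covariance `Σ_AA`.

For the purity, the Moyal identity, checked on coherent states and extended by density, reconstructs
`T` as a weak integral of reflections against its Wigner function. Hence `Tr T²` is a multiple of
the integral of the squared Wigner function, a Gaussian integral. A density operator is pure exactly
when this trace is one, which is the determinant condition.

For the symplectic form, put `G = (2/ħ) Σ_AA` and `P = √G`. The uncertainty principle makes `i P⁻¹ J
P⁻¹` a Hermitian contraction. If `det G = 1`, its determinant has modulus one, so it squares to the
identity; uniqueness of positive square roots then yields `P J P = J`. -/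

/-! ### Hilbert–Schmidt operators and cyclicity of the trace -/

section HilbertSchmidt

set_option linter.unusedSectionVars false

open scoped InnerProduct

variable {H K : Type} [NormedAddCommGroup H] [InnerProductSpace ℂ H] [CompleteSpace H]
  [NormedAddCommGroup K] [InnerProductSpace ℂ K] [CompleteSpace K]

/-- Hilbert–Schmidt operators: `∑ ‖A (b j)‖ ^ 2` converges in orthonormal bases. -/
def IsHilbertSchmidt (A : H →L[ℂ] K) : Prop :=
  ∀ (J : Type) (b : HilbertBasis J ℂ H), Summable fun j => ‖A (b j)‖ ^ 2

theorem HilbertBasis.hasSum_norm_inner_sq {J : Type} (b : HilbertBasis J ℂ H) (x : H) :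
    HasSum (fun j => ‖⟪b j, x⟫_ℂ‖ ^ 2) (‖x‖ ^ 2) := by
  have h := b.hasSum_inner_mul_inner x x
  have h2 : ∀ j, ⟪x, b j⟫_ℂ * ⟪b j, x⟫_ℂ = ((‖⟪b j, x⟫_ℂ‖ ^ 2 : ℝ) : ℂ) := fun j => by
    rw [← inner_conj_symm x (b j), Complex.conj_mul']
    push_cast; rfl
  have h3 : ⟪x, x⟫_ℂ = ((‖x‖ ^ 2 : ℝ) : ℂ) := by
    rw [inner_self_eq_norm_sq_to_K]; push_cast; rfl
  simp only [h2, h3] at h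
  exact Complex.hasSum_ofReal.1 h

theorem summable_matrixElements {A : H →L[ℂ] K} {J L : Type} (b : HilbertBasis J ℂ H)
    (c : HilbertBasis L ℂ K) (hA : Summable fun j => ‖A (b j)‖ ^ 2) :
    Summable fun p : J × L => ‖⟪c p.2, A (b p.1)⟫_ℂ‖ ^ 2 := by
  rw [summable_prod_of_nonneg (fun p => by positivity)]
  refine ⟨fun j => (c.hasSum_norm_inner_sq (A (b j))).summable, ?_⟩
  simpa only [(c.hasSum_norm_inner_sq (A (b _))).tsum_eq] using hA

/-- Tonelli: the squared matrix elements `‖⟪c k, A (b j)⟫‖²` form one nonnegative double family,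
whose sums over `k` and over `j` are `‖A (b j)‖²` and `‖A† (c k)‖²`. -/
theorem summable_norm_adjoint_sq {A : H →L[ℂ] K} {J L : Type} (b : HilbertBasis J ℂ H)
    (c : HilbertBasis L ℂ K) (hA : Summable fun j => ‖A (b j)‖ ^ 2) :
    Summable fun k => ‖(A†) (c k)‖ ^ 2 := by
  have h := (summable_prod_of_nonneg (fun p => by positivity)).1
    (summable_matrixElements b c hA).prod_symm
  have h2 : ∀ k, ∑' j, ‖⟪c k, A (b j)⟫_ℂ‖ ^ 2 = ‖(A†) (c k)‖ ^ 2 := fun k => by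
    rw [← (b.hasSum_norm_inner_sq ((A†) (c k))).tsum_eq]
    refine tsum_congr fun j => ?_
    rw [ContinuousLinearMap.adjoint_inner_right, ← inner_conj_symm, RCLike.norm_conj]
  simpa only [Prod.fst_swap, Prod.snd_swap, Prod.swap, h2] using h.2

theorem IsHilbertSchmidt.adjoint {A : H →L[ℂ] K} (hA : IsHilbertSchmidt A) :
    IsHilbertSchmidt (A†) := by
  obtain ⟨w, b, -⟩ := exists_hilbertBasis ℂ H
  exact fun J c => summable_norm_adjoint_sq b c (hA _ b)

theorem IsHilbertSchmidt.comp_left {A : H →L[ℂ] K} (hA : IsHilbertSchmidt A)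
    {L : Type} [NormedAddCommGroup L] [InnerProductSpace ℂ L] [CompleteSpace L]
    (Y : K →L[ℂ] L) : IsHilbertSchmidt (Y ∘L A) := fun J b => by
  refine Summable.of_nonneg_of_le (fun j => by positivity) (fun j => ?_)
    ((hA J b).mul_left (‖Y‖ ^ 2))
  rw [← mul_pow]
  exact pow_le_pow_left₀ (norm_nonneg _) (Y.le_opNorm _) 2

theorem IsHilbertSchmidt.comp_right {A : H →L[ℂ] K} (hA : IsHilbertSchmidt A)
    {L : Type} [NormedAddCommGroup L] [InnerProductSpace ℂ L] [CompleteSpace L]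
    (Y : L →L[ℂ] H) : IsHilbertSchmidt (A ∘L Y) := by
  have h := (hA.adjoint.comp_left (Y†)).adjoint
  rwa [← ContinuousLinearMap.adjoint_comp, ContinuousLinearMap.adjoint_adjoint] at h

theorem summable_mul_of_sq {J : Type} {f g : J → ℝ} (hf : Summable fun j => f j ^ 2)
    (hg : Summable fun j => g j ^ 2) (hf0 : ∀ j, 0 ≤ f j) (hg0 : ∀ j, 0 ≤ g j) :
    Summable fun j => f j * g j :=
  Summable.of_nonneg_of_le (fun j => mul_nonneg (hf0 j) (hg0 j))
    (fun j => by nlinarith [sq_nonneg (f j - g j), sq_nonneg (f j), sq_nonneg (g j)])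
    (hf.add hg)

theorem IsHilbertSchmidt.summable_norm_inner {A B : H →L[ℂ] K} (hA : IsHilbertSchmidt A)
    (hB : IsHilbertSchmidt B) {J : Type} (b : HilbertBasis J ℂ H) :
    Summable fun j => ‖⟪A (b j), B (b j)⟫_ℂ‖ :=
  Summable.of_nonneg_of_le (fun _ => norm_nonneg _) (fun _ => norm_inner_le_norm _ _)
    (summable_mul_of_sq (hA J b) (hB J b) (fun _ => norm_nonneg _) (fun _ => norm_nonneg _))

/-- Cyclicity of the trace of a product of Hilbert–Schmidt operators, as an identity between the
traces in a basis of the source and a basis of the target. -/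
theorem IsHilbertSchmidt.tsum_inner_eq {A B : H →L[ℂ] K} (hA : IsHilbertSchmidt A)
    (hB : IsHilbertSchmidt B) {J L : Type} (b : HilbertBasis J ℂ H) (c : HilbertBasis L ℂ K) :
    ∑' j, ⟪A (b j), B (b j)⟫_ℂ = ∑' k, ⟪(B†) (c k), (A†) (c k)⟫_ℂ := by
  have hs : Summable fun p : J × L => ⟪A (b p.1), c p.2⟫_ℂ * ⟪c p.2, B (b p.1)⟫_ℂ := by
    refine Summable.of_norm ?_
    have hn : ∀ p : J × L, ‖⟪A (b p.1), c p.2⟫_ℂ * ⟪c p.2, B (b p.1)⟫_ℂ‖ =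
        ‖⟪c p.2, A (b p.1)⟫_ℂ‖ * ‖⟪c p.2, B (b p.1)⟫_ℂ‖ := fun p => by
      rw [norm_mul, norm_inner_symm]
    simp only [hn]
    exact summable_mul_of_sq (summable_matrixElements b c (hA J b))
      (summable_matrixElements b c (hB J b)) (fun _ => norm_nonneg _) (fun _ => norm_nonneg _)
  have h1 : ∀ j, ∑' k, ⟪A (b j), c k⟫_ℂ * ⟪c k, B (b j)⟫_ℂ = ⟪A (b j), B (b j)⟫_ℂ := fun j =>
    (c.hasSum_inner_mul_inner _ _).tsum_eq
  have h2 : ∀ k, ∑' j, ⟪A (b j), c k⟫_ℂ * ⟪c k, B (b j)⟫_ℂ = ⟪(B†) (c k), (A†) (c k)⟫_ℂ := by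
    intro k
    rw [← (b.hasSum_inner_mul_inner _ _).tsum_eq]
    refine tsum_congr fun j => ?_
    rw [ContinuousLinearMap.adjoint_inner_left, ContinuousLinearMap.adjoint_inner_right, mul_comm]
  have h3 : ∑' j, ∑' k, ⟪A (b j), c k⟫_ℂ * ⟪c k, B (b j)⟫_ℂ =
      ∑' k, ∑' j, ⟪A (b j), c k⟫_ℂ * ⟪c k, B (b j)⟫_ℂ :=
    (Summable.tsum_comm (f := fun j k => ⟪A (b j), c k⟫_ℂ * ⟪c k, B (b j)⟫_ℂ) hs).symm
  simp only [h1, h2] at h3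
  exact h3

/-- `tsum_inner_eq` couples an arbitrary basis of one space to an arbitrary basis of the other.
Holding one of them fixed shows that the trace does not depend on the other. -/
theorem IsHilbertSchmidt.exists_hasTrace {A B : H →L[ℂ] K} (hA : IsHilbertSchmidt A)
    (hB : IsHilbertSchmidt B) : ∃ t, HasTrace (A† ∘L B) t ∧ HasTrace (B ∘L A†) t := by
  obtain ⟨w, b₀, -⟩ := exists_hilbertBasis ℂ H
  obtain ⟨v, c₀, -⟩ := exists_hilbertBasis ℂ K
  refine ⟨∑' j, ⟪A (b₀ j), B (b₀ j)⟫_ℂ, fun J b => ?_, fun L c => ?_⟩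
  · rw [hA.tsum_inner_eq hB b₀ c₀, ← hA.tsum_inner_eq hB b c₀]
    simp only [ContinuousLinearMap.comp_apply, ContinuousLinearMap.adjoint_inner_right]
    exact (hA.summable_norm_inner hB b).of_norm.hasSum
  · rw [hA.tsum_inner_eq hB b₀ c]
    have hc : ∀ k, ⟪c k, (B ∘L A†) (c k)⟫_ℂ = ⟪(B†) (c k), (A†) (c k)⟫_ℂ := fun k => by
      rw [ContinuousLinearMap.comp_apply, ContinuousLinearMap.adjoint_inner_left]
    simp only [hc]
    exact (hB.adjoint.summable_norm_inner hA.adjoint c).of_norm.hasSum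

theorem HasTrace.unique {T : H →L[ℂ] H} {s t : ℂ} (hs : HasTrace T s) (ht : HasTrace T t) :
    s = t := by
  obtain ⟨w, b, -⟩ := exists_hilbertBasis ℂ H
  exact (hs _ b).unique (ht _ b)

theorem isTraceClass_of_isPositive {T : H →L[ℂ] H} (hT : T.IsPositive) {t : ℂ}
    (ht : HasTrace T t) : IsTraceClass T := fun J b => by
  rw [CFC.abs_of_nonneg T ((ContinuousLinearMap.nonneg_iff_isPositive T).2 hT)]
  exact (ht J b).summable

/-- A positive trace class operator is the square of a self-adjoint Hilbert–Schmidt operator. -/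
theorem exists_hilbertSchmidt_sqrt {T : H →L[ℂ] H} (hT : T.IsPositive) (hT' : IsTraceClass T) :
    ∃ S : H →L[ℂ] H, S† = S ∧ IsHilbertSchmidt S ∧ T = S ∘L S := by
  have h0 : 0 ≤ T := (ContinuousLinearMap.nonneg_iff_isPositive T).2 hT
  have hS : (CFC.sqrt T) ∘L (CFC.sqrt T) = T := CFC.sqrt_mul_sqrt_self T h0
  have hadj : (CFC.sqrt T)† = CFC.sqrt T :=
    ((ContinuousLinearMap.nonneg_iff_isPositive _).1 (CFC.sqrt_nonneg T)).isSelfAdjoint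
  refine ⟨CFC.sqrt T, hadj, fun J b => ?_, hS.symm⟩
  have h := hT' J b
  rw [CFC.abs_of_nonneg T h0] at h
  have h2 : ∀ j, ⟪b j, T (b j)⟫_ℂ = ((‖CFC.sqrt T (b j)‖ ^ 2 : ℝ) : ℂ) := fun j => by
    conv_lhs => rw [← hS, ContinuousLinearMap.comp_apply,
      ← ContinuousLinearMap.adjoint_inner_left, hadj, inner_self_eq_norm_sq_to_K]
    push_cast; rfl
  simp only [h2] at h
  exact_mod_cast h

/-- For `T = S S` with `S` self-adjoint and Hilbert–Schmidt, `T Y`, `Y T` and `S Y S` have the same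
trace. -/
theorem exists_hasTrace_sandwich {S : H →L[ℂ] H} (hS : S† = S) (hHS : IsHilbertSchmidt S)
    (Y : H →L[ℂ] H) : ∃ t, HasTrace ((S ∘L S) ∘L Y) t ∧ HasTrace (Y ∘L (S ∘L S)) t ∧
      ∀ (J : Type) (b : HilbertBasis J ℂ H), HasSum (fun j => ⟪S (b j), Y (S (b j))⟫_ℂ) t := by
  obtain ⟨t, h1, h2⟩ := hHS.exists_hasTrace (hHS.comp_right Y)
  obtain ⟨t', h3, h4⟩ := (hHS.comp_right (Y†)).exists_hasTrace hHS
  rw [ContinuousLinearMap.adjoint_comp, ContinuousLinearMap.adjoint_adjoint, hS] at h3 h4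
  rw [hS] at h1 h2
  have h2' : HasTrace (S ∘L Y ∘L S) t := h2
  -- `S Y S` occurs in both uses of cyclicity, so its trace identifies those of `S S Y` and `Y S S`.
  obtain rfl := h2'.unique h4
  refine ⟨t, h1, h3, fun J b => ?_⟩
  have hb : ∀ j, ⟪b j, (S ∘L Y ∘L S) (b j)⟫_ℂ = ⟪S (b j), Y (S (b j))⟫_ℂ := fun j => by
    conv_rhs => rw [← hS, ContinuousLinearMap.adjoint_inner_left, hS]
    rfl
  simpa only [hb] using h2' J b

end HilbertSchmidt

/-! ### Pure states among density operators -/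

section Purity

set_option linter.unusedSectionVars false

open scoped InnerProduct

variable {H : Type} [NormedAddCommGroup H] [InnerProductSpace ℂ H] [CompleteSpace H]

/-- Through this, a fact about traces in every basis becomes a fact about each single unit vector.
-/
theorem exists_hilbertBasis_mem {x : H} (hx : ‖x‖ = 1) :
    ∃ (w : Set H) (b : HilbertBasis w ℂ H) (j : w), b j = x := by
  have ho : Orthonormal ℂ ((↑) : ({x} : Set H) → H) := by
    refine ⟨fun i => by rw [i.2, hx], fun i j hij => (hij (Subsingleton.elim _ _)).elim⟩
  obtain ⟨w, b, hw, hb⟩ := ho.exists_hilbertBasis_extension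
  exact ⟨w, b, ⟨x, hw rfl⟩, by rw [hb]⟩

theorem IsPureState.comp_self {T : H →L[ℂ] H} (hT : IsPureState T) : T ∘L T = T := by
  obtain ⟨ψ, hψ, h⟩ := hT
  ext f
  simp [h, hψ]

theorem inner_sq_apply {S : H →L[ℂ] H} (hS : S† = S) (x : H) :
    ⟪x, (S ∘L S) x⟫_ℂ = ((‖S x‖ ^ 2 : ℝ) : ℂ) := by
  rw [ContinuousLinearMap.comp_apply, ← ContinuousLinearMap.adjoint_inner_left, hS,
    inner_self_eq_norm_sq_to_K]
  push_cast; rfl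

/-- A density operator whose square has trace one is pure. -/
theorem IsDensityOperator.isPureState {T : H →L[ℂ] H} (hT : IsDensityOperator T)
    (h2 : HasTrace (T ∘L T) 1) : IsPureState T := by
  obtain ⟨S, hS, -, rfl⟩ := exists_hilbertSchmidt_sqrt hT.positive hT.traceClass
  have hTadj : (S ∘L S)† = S ∘L S := by rw [ContinuousLinearMap.adjoint_comp, hS]
  have hsum : ∀ (w : Set H) (b : HilbertBasis w ℂ H), HasSum (fun j => ‖S (b j)‖ ^ 2) 1 := by
    intro w b
    have := hT.trace_one w b
    simp only [inner_sq_apply hS] at this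
    exact Complex.hasSum_ofReal.1 (by simpa only [Complex.ofReal_one] using this)
  have hsum2 : ∀ (w : Set H) (b : HilbertBasis w ℂ H),
      HasSum (fun j => ‖S (S (b j))‖ ^ 2) 1 := by
    intro w b
    have := h2 w b
    simp only [inner_sq_apply hTadj, ContinuousLinearMap.comp_apply S S] at this
    exact Complex.hasSum_ofReal.1 (by simpa only [Complex.ofReal_one] using this)
  -- `‖S x‖²` is one term of a nonnegative series with sum one.
  have hle1 : ∀ x, ‖x‖ = 1 → ‖S x‖ ≤ 1 := by
    intro x hx
    obtain ⟨w, b, j, rfl⟩ := exists_hilbertBasis_mem hx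
    have := le_hasSum (hsum w b) j (fun _ _ => by positivity)
    exact (sq_le_one_iff₀ (norm_nonneg _)).1 this
  have hle : ∀ x, ‖S x‖ ≤ ‖x‖ := by
    intro x
    rcases eq_or_ne x 0 with rfl | hx
    · simp
    have h := hle1 (((‖x‖ : ℂ))⁻¹ • x) (by simp [norm_smul, hx])
    rw [map_smul, norm_smul, norm_inv, Complex.norm_real, norm_norm] at h
    exact (inv_mul_le_one₀ (norm_pos_iff.2 hx)).1 h
  -- The differences `‖S b‖² - ‖S S b‖²` are nonnegative and sum to `1 - 1 = 0`, so each vanishes.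
  have heq1 : ∀ x, ‖x‖ = 1 → ‖S x‖ ^ 2 = ‖S (S x)‖ ^ 2 := by
    intro x hx
    obtain ⟨w, b, j, rfl⟩ := exists_hilbertBasis_mem hx
    have h := (hsum w b).sub (hsum2 w b)
    rw [sub_self, hasSum_zero_iff_of_nonneg] at h
    · have := congrFun h j
      simp only [Pi.zero_apply] at this
      linarith
    · intro i
      simp only [sub_nonneg]
      exact pow_le_pow_left₀ (norm_nonneg _) (hle _) 2
  have heq : ∀ x, ‖S x‖ ^ 2 = ‖S (S x)‖ ^ 2 := by
    intro x
    rcases eq_or_ne x 0 with rfl | hx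
    · simp
    have h := heq1 (((‖x‖ : ℂ))⁻¹ • x) (by simp [norm_smul, hx])
    simp only [map_smul, norm_smul, norm_inv, Complex.norm_real, norm_norm, mul_pow] at h
    have hx' : (‖x‖⁻¹) ^ 2 ≠ 0 := by simpa using hx
    exact mul_left_cancel₀ hx' h
  -- The quadratic form of `T² - T` vanishes, hence so does the operator, the scalars being complex:
  -- `T = S S` is a projection.
  have hproj : ∀ x, S (S (S (S x))) = S (S x) := by
    have : ((S ∘L S) ∘L (S ∘L S) - S ∘L S : H →L[ℂ] H) = 0 := by
      rw [← ContinuousLinearMap.coe_inj]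
      refine inner_map_self_eq_zero _ |>.1 fun x => ?_
      rw [← inner_conj_symm]
      have h1 := inner_sq_apply hS x
      have h2 := inner_sq_apply hTadj x
      rw [ContinuousLinearMap.coe_coe, sub_apply, inner_sub_right, h1, h2,
        ContinuousLinearMap.comp_apply, ← heq x, sub_self, map_zero]
    intro x
    have h := congrArg (fun A : H →L[ℂ] H => A x) this
    simpa [sub_eq_zero] using h
  obtain ⟨x, hx⟩ : ∃ x, S (S x) ≠ 0 := by
    by_contra! h
    obtain ⟨w, b, -⟩ := exists_hilbertBasis ℂ H
    have h1 := hT.trace_one w b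
    simp only [ContinuousLinearMap.comp_apply, h, inner_zero_right] at h1
    exact zero_ne_one (hasSum_zero.unique h1)
  set ψ : H := ((‖S (S x)‖ : ℂ))⁻¹ • S (S x) with hψ
  have hψ1 : ‖ψ‖ = 1 := by simp [hψ, norm_smul, hx]
  have hTψ : S (S ψ) = ψ := by rw [hψ, map_smul, map_smul, hproj]
  have hSψ : ‖S ψ‖ ^ 2 = 1 := by rw [heq ψ, hTψ, hψ1, one_pow]
  refine ⟨ψ, hψ1, fun f => ?_⟩
  obtain ⟨w, b, j, hj⟩ := exists_hilbertBasis_mem hψ1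
  -- In a basis containing the fixed vector `ψ`, the term `‖S ψ‖² = 1` exhausts the trace, so `T`
  -- kills all other basis vectors.
  have hext : S ∘L S = (innerSL ℂ ψ).smulRight ψ := by
    refine ContinuousLinearMap.ext_on
      (Submodule.dense_iff_topologicalClosure_eq_top.2 b.dense_span) ?_
    rintro _ ⟨i, rfl⟩
    simp only [ContinuousLinearMap.comp_apply, ContinuousLinearMap.smulRight_apply,
      innerSL_apply_apply]
    by_cases hij : i = j
    · rw [hij, hj, hTψ, inner_self_eq_norm_sq_to_K, hψ1]; simp
    · have h0 : ‖S (b i)‖ ^ 2 = 0 := by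
        classical
        have h1 := hsum w b
        have h2 := sum_le_hasSum {i, j} (fun _ _ => by positivity) h1
        rw [Finset.sum_pair hij, hj, hSψ] at h2
        exact le_antisymm (by linarith) (by positivity)
      rw [norm_eq_zero.1 (pow_eq_zero_iff two_ne_zero |>.1 h0), ← hj,
        b.orthonormal.2 (Ne.symm hij)]
      simp
  exact congrArg (fun A : H →L[ℂ] H => A f) hext

end Purity

/-! ### Extension of weak integral identities from total sets -/

section TotalSets

set_option linter.unusedSectionVars false

variable {H K : Type} [NormedAddCommGroup H] [InnerProductSpace ℂ H] [CompleteSpace H]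
  [NormedAddCommGroup K] [InnerProductSpace ℂ K] [CompleteSpace K]

theorem dense_span_of_forall_inner_eq_zero {D : Set H}
    (hD : ∀ f : H, (∀ a ∈ D, ⟪a, f⟫_ℂ = 0) → f = 0) :
    Dense (Submodule.span ℂ D : Set H) := by
  rw [Submodule.dense_iff_topologicalClosure_eq_top, Submodule.topologicalClosure_eq_top_iff,
    Submodule.eq_bot_iff]
  exact fun f hf => hD f fun a ha => (Submodule.mem_orthogonal _ _).1 hf a
    (Submodule.subset_span ha)

/-- Two bounded operators with the same matrix elements on a total set are equal. -/
theorem inner_apply_eq_of_dense_span {D : Set H} (hD : Dense (Submodule.span ℂ D : Set H))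
    {A B : H →L[ℂ] H} (h : ∀ a ∈ D, ∀ a' ∈ D, ⟪a, A a'⟫_ℂ = ⟪a, B a'⟫_ℂ) : A = B := by
  refine ContinuousLinearMap.ext_on hD fun a' ha' => ?_
  have h2 : innerSL ℂ (A a') = innerSL ℂ (B a') := by
    refine ContinuousLinearMap.ext_on hD fun a ha => ?_
    simp only [innerSL_apply_apply]
    rw [← inner_conj_symm, h a ha a' ha', inner_conj_symm]
  exact ext_inner_right ℂ fun v => by simpa using congrArg (fun l => l v) h2

variable {Ω : Type} [TopologicalSpace Ω]

/-- A uniformly bounded family of operators that is strongly continuous on a total set is strongly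
continuous. -/
theorem continuous_apply_of_dense_span {D : Set H}
    (hD : Dense (Submodule.span ℂ D : Set H)) {Y : Ω → H →L[ℂ] K} {C : ℝ} (hC : ∀ w, ‖Y w‖ ≤ C)
    (h : ∀ a ∈ D, Continuous fun w => Y w a) (a : H) : Continuous fun w => Y w a := by
  have hspan : ∀ a ∈ Submodule.span ℂ D, Continuous fun w => Y w a := by
    intro a ha
    induction ha using Submodule.span_induction with
    | mem x hx => exact h x hx
    | zero => simpa using continuous_const
    | add x y _ _ hx hy => simp only [map_add]; exact hx.add hy
    | smul c x _ hx => simp only [map_smul]; exact hx.const_smul c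
  refine continuous_of_uniform_approx_of_continuous fun u hu => ?_
  obtain ⟨ε, hε, hu⟩ := Metric.mem_uniformity_dist.1 hu
  have hC' : 0 < |C| + 1 := by positivity
  obtain ⟨a', ha', hd⟩ := Metric.dense_iff.1 hD a (ε / (|C| + 1)) (by positivity)
  refine ⟨fun w => Y w a', hspan a' hd, fun w => hu ?_⟩
  rw [dist_eq_norm, ← map_sub]
  rw [Metric.mem_ball, dist_comm, dist_eq_norm, lt_div_iff₀ hC'] at ha'
  calc ‖Y w (a - a')‖ ≤ ‖Y w‖ * ‖a - a'‖ := (Y w).le_opNorm _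
    _ ≤ (|C| + 1) * ‖a - a'‖ := by
        gcongr
        exact (hC w).trans ((le_abs_self C).trans (by linarith))
    _ < ε := by linarith

variable [MeasurableSpace Ω] [OpensMeasurableSpace Ω] [SecondCountableTopology Ω]
  [TopologicalSpace.PseudoMetrizableSpace Ω] {μ : Measure Ω}

theorem integrable_smul_apply {Y : Ω → H →L[ℂ] K} {C : ℝ} (hC : ∀ w, ‖Y w‖ ≤ C)
    (hY : ∀ a, Continuous fun w => Y w a) {f : Ω → ℂ} (hf : Integrable f μ) (a : H) :
    Integrable (fun w => f w • Y w a) μ := by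
  refine (hf.norm.mul_const (C * ‖a‖)).mono' (hf.1.smul (hY a).aestronglyMeasurable) ?_
  refine Filter.Eventually.of_forall fun w => ?_
  rw [norm_smul]
  gcongr
  exact (Y w).le_of_opNorm_le (hC w) a

/-- The weak integral `∫ f(w) Y(w) dw` of a strongly continuous bounded family of operators. -/
theorem exists_weakIntegral {Y : Ω → H →L[ℂ] K} {C : ℝ} (hC : ∀ w, ‖Y w‖ ≤ C)
    (hY : ∀ a, Continuous fun w => Y w a) {f : Ω → ℂ} (hf : Integrable f μ) :
    ∃ A : H →L[ℂ] K, ∀ a a', ⟪a', A a⟫_ℂ = ∫ w, f w * ⟪a', Y w a⟫_ℂ ∂μ := by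
  have hint := integrable_smul_apply hC hY hf
  let A : H →ₗ[ℂ] K :=
    { toFun := fun a => ∫ w, f w • Y w a ∂μ
      map_add' := fun a b => by
        simp only [map_add, smul_add]
        exact integral_add (hint a) (hint b)
      map_smul' := fun c a => by
        simp only [map_smul, RingHom.id_apply]
        rw [← integral_smul]
        simp only [smul_comm c] }
  refine ⟨A.mkContinuous (∫ w, ‖f w‖ * C ∂μ) fun a => ?_, fun a a' => ?_⟩
  · refine (norm_integral_le_integral_norm _).trans ?_
    rw [← integral_mul_const]
    refine integral_mono (hint a).norm ((hf.norm.mul_const C).mul_const _) fun w => ?_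
    simp only [norm_smul, mul_assoc]
    gcongr
    exact (Y w).le_of_opNorm_le (hC w) a
  · change ⟪a', ∫ w, f w • Y w a ∂μ⟫_ℂ = _
    rw [← integral_inner (hint a)]
    simp only [inner_smul_right]

/-- The weak integral is itself a bounded operator, so its equality with `B` need only be tested on
a total set. -/
theorem integral_inner_eq_of_dense_span {D : Set H}
    (hD : Dense (Submodule.span ℂ D : Set H)) {Y : Ω → H →L[ℂ] H} {C : ℝ} (hC : ∀ w, ‖Y w‖ ≤ C)
    (hY : ∀ a, Continuous fun w => Y w a) {f : Ω → ℂ} (hf : Integrable f μ) (B : H →L[ℂ] H)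
    (h : ∀ a ∈ D, ∀ a' ∈ D, ∫ w, f w * ⟪a, Y w a'⟫_ℂ ∂μ = ⟪a, B a'⟫_ℂ) (a a' : H) :
    ∫ w, f w * ⟪a, Y w a'⟫_ℂ ∂μ = ⟪a, B a'⟫_ℂ := by
  obtain ⟨A, hA⟩ := exists_weakIntegral hC hY hf
  have : A = B := inner_apply_eq_of_dense_span hD fun a ha a' ha' => by
    rw [hA, h a ha a' ha']
  rw [← hA, this]

/-- A bounded strongly continuous family of operators that is a tight frame with constant `κ` on a
total set is a tight frame. -/
theorem integral_inner_frame {D : Set H} (hD : Dense (Submodule.span ℂ D : Set H))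
    {L : Ω → H →L[ℂ] K} (hL : ∀ a, Continuous fun w => L w a) {κ : ℝ} (hκ : 0 ≤ κ)
    (h : ∀ a ∈ D, ∀ a' ∈ D, Integrable (fun w => ⟪L w a, L w a'⟫_ℂ) μ ∧
      ∫ w, ⟪L w a, L w a'⟫_ℂ ∂μ = κ * ⟪a, a'⟫_ℂ) (a a' : H) :
    Integrable (fun w => ⟪L w a, L w a'⟫_ℂ) μ ∧
      ∫ w, ⟪L w a, L w a'⟫_ℂ ∂μ = κ * ⟪a, a'⟫_ℂ := by
  have hspan1 : ∀ a ∈ D, ∀ a' ∈ Submodule.span ℂ D, Integrable (fun w => ⟪L w a, L w a'⟫_ℂ) μ ∧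
      ∫ w, ⟪L w a, L w a'⟫_ℂ ∂μ = κ * ⟪a, a'⟫_ℂ := by
    intro a ha a' ha'
    induction ha' using Submodule.span_induction with
    | mem x hx => exact h a ha x hx
    | zero => simp
    | add x y _ _ hx hy =>
      simp only [map_add, inner_add_right]
      exact ⟨hx.1.add hy.1, by rw [integral_add hx.1 hy.1, hx.2, hy.2, mul_add]⟩
    | smul c x _ hx =>
      simp only [map_smul, inner_smul_right]
      exact ⟨hx.1.const_mul c, by rw [integral_const_mul, hx.2]; ring⟩
  have hspan : ∀ a ∈ Submodule.span ℂ D, ∀ a' ∈ Submodule.span ℂ D,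
      Integrable (fun w => ⟪L w a, L w a'⟫_ℂ) μ ∧
      ∫ w, ⟪L w a, L w a'⟫_ℂ ∂μ = κ * ⟪a, a'⟫_ℂ := by
    intro a ha a' ha'
    induction ha using Submodule.span_induction with
    | mem x hx => exact hspan1 x hx a' ha'
    | zero => simp
    | add x y _ _ hx hy =>
      simp only [map_add, inner_add_left]
      exact ⟨hx.1.add hy.1, by rw [integral_add hx.1 hy.1, hx.2, hy.2, mul_add]⟩
    | smul c x _ hx =>
      simp only [map_smul, inner_smul_left]
      exact ⟨hx.1.const_mul _, by rw [integral_const_mul, hx.2]; ring⟩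
  have hm : ∀ a, AEStronglyMeasurable (fun w => L w a) μ := fun a => (hL a).aestronglyMeasurable
  have hl : ∀ a ∈ Submodule.span ℂ D,
      ∫⁻ w, ‖L w a‖ₑ ^ 2 ∂μ = ENNReal.ofReal (κ * ‖a‖ ^ 2) := by
    intro a ha
    obtain ⟨hi, he⟩ := hspan a ha a ha
    have hr : ∀ w, ⟪L w a, L w a⟫_ℂ = ((‖L w a‖ ^ 2 : ℝ) : ℂ) := fun w => by
      rw [inner_self_eq_norm_sq_to_K]; push_cast; rfl
    have hr' : (κ : ℂ) * ⟪a, a⟫_ℂ = ((κ * ‖a‖ ^ 2 : ℝ) : ℂ) := by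
      rw [inner_self_eq_norm_sq_to_K]; push_cast; rfl
    simp only [hr] at hi he
    rw [integral_complex_ofReal, hr', Complex.ofReal_inj] at he
    rw [← he, ofReal_integral_eq_lintegral_ofReal (by exact_mod_cast hi.re)
      (Filter.Eventually.of_forall fun w => by positivity)]
    refine lintegral_congr fun w => ?_
    rw [ENNReal.ofReal_pow (norm_nonneg _), ofReal_norm]
  -- Off the span the identity is not yet known. Fatou along an approximating sequence gives an
  -- inequality, which suffices for square integrability.
  have hfatou : ∀ a, ∫⁻ w, ‖L w a‖ₑ ^ 2 ∂μ ≤ ENNReal.ofReal (κ * ‖a‖ ^ 2) := by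
    intro a
    obtain ⟨s, hs, hsa⟩ := mem_closure_iff_seq_limit.1 (hD a)
    have h1 : ∀ w, ‖L w a‖ₑ ^ 2 = Filter.liminf (fun n => ‖L w (s n)‖ₑ ^ 2) Filter.atTop := by
      intro w
      refine (Filter.Tendsto.liminf_eq ?_).symm
      have h2 : Filter.Tendsto (fun n => ‖L w (s n)‖ₑ) Filter.atTop (nhds ‖L w a‖ₑ) :=
        (continuous_enorm.tendsto _).comp (((L w).continuous.tendsto a).comp hsa)
      exact ENNReal.Tendsto.pow h2
    simp only [h1]
    refine (lintegral_liminf_le' fun n => ((hm (s n)).enorm.pow_const 2)).trans ?_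
    simp only [hl _ (hs _)]
    refine le_of_eq (Filter.Tendsto.liminf_eq ?_)
    refine (ENNReal.continuous_ofReal.tendsto _).comp ?_
    exact ((hsa.norm.pow 2).const_mul κ)
  have hmem : ∀ a, MemLp (fun w => L w a) 2 μ := by
    intro a
    refine ⟨hm a, ?_⟩
    rw [eLpNorm_lt_top_iff_lintegral_rpow_enorm_lt_top two_ne_zero ENNReal.ofNat_ne_top]
    simpa using (hfatou a).trans_lt ENNReal.ofReal_lt_top
  -- The analysis operator of the frame. Being bounded into `L²`, it lets the identity pass from the
  -- span to all of `H` by continuity.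
  let T₀ : H →ₗ[ℂ] Lp K 2 μ :=
    { toFun := fun a => (hmem a).toLp _
      map_add' := fun a b => by
        rw [← MemLp.toLp_add]; congr 1; ext w; simp
      map_smul' := fun c a => by
        rw [RingHom.id_apply, ← MemLp.toLp_const_smul]; congr 1; ext w; simp }
  have hinner : ∀ a b, ⟪T₀ a, T₀ b⟫_ℂ = ∫ w, ⟪L w a, L w b⟫_ℂ ∂μ := by
    intro a b
    rw [L2.inner_def]
    refine integral_congr_ae ?_
    filter_upwards [(hmem a).coeFn_toLp, (hmem b).coeFn_toLp] with w h1 h2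
    change ⟪(hmem a).toLp _ w, (hmem b).toLp _ w⟫_ℂ = _
    rw [h1, h2]
  have hbound : ∀ a, ‖T₀ a‖ ≤ Real.sqrt κ * ‖a‖ := by
    intro a
    have h1 : ‖T₀ a‖ = (eLpNorm (fun w => L w a) 2 μ).toReal := Lp.norm_toLp _ (hmem a)
    have h2 : eLpNorm (fun w => L w a) 2 μ ^ 2 = ∫⁻ w, ‖L w a‖ₑ ^ 2 ∂μ := by
      have := eLpNorm_nnreal_pow_eq_lintegral (f := fun w => L w a) (μ := μ) (p := 2)
        (by norm_num)
      simpa using this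
    have h3 : ‖T₀ a‖ ^ 2 ≤ κ * ‖a‖ ^ 2 := by
      rw [h1, ← ENNReal.toReal_pow, h2]
      exact ENNReal.toReal_le_of_le_ofReal (by positivity) (hfatou a)
    rw [← Real.sqrt_sq (norm_nonneg a), ← Real.sqrt_mul hκ]
    exact Real.le_sqrt_of_sq_le h3
  let T : H →L[ℂ] Lp K 2 μ := T₀.mkContinuous _ hbound
  have hclosed : ∀ p : H × H, ⟪T p.1, T p.2⟫_ℂ = κ * ⟪p.1, p.2⟫_ℂ := by
    refine congrFun (Continuous.ext_on (hD.prod hD) ?_ ?_ ?_)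
    · exact (T.continuous.comp continuous_fst).inner (T.continuous.comp continuous_snd)
    · exact continuous_const.mul (continuous_fst.inner continuous_snd)
    · rintro ⟨a, b⟩ ⟨ha, hb⟩
      exact (hinner a b).trans (hspan a ha b hb).2
  refine ⟨?_, (hinner a a').symm.trans (hclosed (a, a'))⟩
  refine (L2.integrable_inner (𝕜 := ℂ) (T₀ a) (T₀ a')).congr ?_
  filter_upwards [(hmem a).coeFn_toLp, (hmem a').coeFn_toLp] with w h1 h2
  change ⟪(hmem a).toLp _ w, (hmem a').toLp _ w⟫_ℂ = _
  rw [h1, h2]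

end TotalSets

/-! ### Diagonal Gaussian integrals with complex linear terms -/

section GaussianIntegral

variable {κ : Type} [Fintype κ]

theorem integrable_cexp_quadratic_pi {β : κ → ℝ} (hβ : ∀ j, 0 < β j) (c : κ → ℂ) :
    Integrable fun v : κ → ℝ => Complex.exp (∑ j, (-(β j : ℂ) * (v j : ℂ) ^ 2 + c j * v j)) := by
  have := GaussianFourier.integrable_cexp_neg_sum_mul_add (b := fun j => (β j : ℂ))
    (fun j => by simpa using hβ j) c
  simpa only [neg_mul, Finset.sum_add_distrib, Finset.sum_neg_distrib] using this

theorem integral_cexp_quadratic_pi {β : κ → ℝ} (hβ : ∀ j, 0 < β j) (c : κ → ℂ) :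
    ∫ v : κ → ℝ, Complex.exp (∑ j, (-(β j : ℂ) * (v j : ℂ) ^ 2 + c j * v j)) =
      ((∏ j, Real.sqrt (Real.pi / β j) : ℝ) : ℂ) * Complex.exp (∑ j, c j ^ 2 / (4 * β j)) := by
  have := GaussianFourier.integral_cexp_neg_sum_mul_add (b := fun j => (β j : ℂ))
    (fun j => by simpa using hβ j) c
  rw [Finset.prod_mul_distrib, ← Complex.exp_sum] at this
  have h2 : ∏ j, ((Real.pi : ℂ) / β j) ^ (1 / 2 : ℂ) =
      ((∏ j, Real.sqrt (Real.pi / β j) : ℝ) : ℂ) := by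
    push_cast
    refine Finset.prod_congr rfl fun j _ => ?_
    rw [Real.sqrt_eq_rpow, Complex.ofReal_cpow (div_nonneg Real.pi_pos.le (hβ j).le)]
    push_cast; rfl
  rw [h2] at this
  simpa only [neg_mul, Finset.sum_add_distrib, Finset.sum_neg_distrib] using this

end GaussianIntegral

/-! ### Grossmann–Royer reflections and the Wigner transform -/

section PhaseOperators

variable {ι : Type} [Fintype ι]

/-- Composition with a measure preserving map followed by multiplication by a phase. -/
theorem exists_phaseComp {τ : (ι → ℝ) → (ι → ℝ)} (hτ : MeasurePreserving τ volume volume)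
    {θ : (ι → ℝ) → ℂ} (hθ : Measurable θ) (hθ1 : ∀ y, ‖θ y‖ = 1) :
    ∃ U : L2 ι →L[ℂ] L2 ι, (∀ φ, ‖U φ‖ = ‖φ‖) ∧ ∀ φ : L2 ι, U φ =ᵐ[volume] fun y => θ y * φ (τ y) := by
  have hm : ∀ φ : L2 ι, MemLp (fun y => θ y * φ (τ y)) 2 volume := fun φ => by
    have h := (Lp.memLp φ).comp_measurePreserving hτ
    refine h.of_le (hθ.aestronglyMeasurable.mul h.1) (Filter.Eventually.of_forall fun y => ?_)
    simp [hθ1]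
  have hnorm : ∀ φ : L2 ι, ‖(hm φ).toLp _‖ = ‖φ‖ := fun φ => by
    rw [Lp.norm_toLp, Lp.norm_def]
    congr 1
    rw [← eLpNorm_comp_measurePreserving (Lp.memLp φ).1 hτ]
    exact eLpNorm_congr_norm_ae (Filter.Eventually.of_forall fun y => by simp [hθ1])
  let U : L2 ι →ₗ[ℂ] L2 ι :=
    { toFun := fun φ => (hm φ).toLp _
      map_add' := fun φ ψ => by
        rw [← MemLp.toLp_add, MemLp.toLp_eq_toLp_iff]
        filter_upwards [hτ.quasiMeasurePreserving.ae (Lp.coeFn_add φ ψ)] with y hy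
        simp only [hy, Pi.add_apply, mul_add]
      map_smul' := fun c φ => by
        rw [RingHom.id_apply, ← MemLp.toLp_const_smul, MemLp.toLp_eq_toLp_iff]
        filter_upwards [hτ.quasiMeasurePreserving.ae (Lp.coeFn_smul c φ)] with y hy
        simp only [hy, Pi.smul_apply, smul_eq_mul]
        ring }
  exact ⟨U.mkContinuous 1 fun φ => by rw [one_mul]; exact (hnorm φ).le, hnorm,
    fun φ => (hm φ).coeFn_toLp⟩

theorem measurePreserving_reflection (x : ι → ℝ) :
    MeasurePreserving (fun y : ι → ℝ => (2 : ℝ) • x - y) volume volume :=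
  Measure.measurePreserving_sub_left volume _

/-- The phase `exp (2 i p · (y - x) / ħ)` at `z = (x, p)`. -/
noncomputable def royerPhase (ħ : ℝ) (z : ι ⊕ ι → ℝ) (y : ι → ℝ) : ℂ :=
  Complex.exp (((2 / ħ * ∑ i, z (Sum.inr i) * (y i - z (Sum.inl i)) : ℝ) : ℂ) * Complex.I)

theorem measurable_royerPhase (ħ : ℝ) (z : ι ⊕ ι → ℝ) : Measurable (royerPhase ħ z) := by
  unfold royerPhase
  fun_prop

theorem norm_royerPhase (ħ : ℝ) (z : ι ⊕ ι → ℝ) (y : ι → ℝ) : ‖royerPhase ħ z y‖ = 1 :=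
  Complex.norm_exp_ofReal_mul_I _

theorem exists_royer (ħ : ℝ) (z : ι ⊕ ι → ℝ) : ∃ U : L2 ι →L[ℂ] L2 ι, (∀ φ, ‖U φ‖ = ‖φ‖) ∧
    ∀ φ : L2 ι, U φ =ᵐ[volume]
      fun y => royerPhase ħ z y * φ ((2 : ℝ) • (fun i => z (Sum.inl i)) - y) :=
  exists_phaseComp (measurePreserving_reflection _) (measurable_royerPhase ħ z)
    (norm_royerPhase ħ z)

/-- The Grossmann–Royer reflection operator at the phase space point `z = (x, p)`:
`(R φ)(y) = exp (2 i p · (y - x) / ħ) φ (2 x - y)`. -/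
noncomputable def royer (ħ : ℝ) (z : ι ⊕ ι → ℝ) : L2 ι →L[ℂ] L2 ι := (exists_royer ħ z).choose

theorem norm_royer_apply (ħ : ℝ) (z : ι ⊕ ι → ℝ) (φ : L2 ι) : ‖royer ħ z φ‖ = ‖φ‖ :=
  (exists_royer ħ z).choose_spec.1 φ

theorem royer_coeFn (ħ : ℝ) (z : ι ⊕ ι → ℝ) (φ : L2 ι) : royer ħ z φ =ᵐ[volume]
    fun y => royerPhase ħ z y * φ ((2 : ℝ) • (fun i => z (Sum.inl i)) - y) :=
  (exists_royer ħ z).choose_spec.2 φ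

theorem norm_royer_le (ħ : ℝ) (z : ι ⊕ ι → ℝ) : ‖royer ħ z‖ ≤ 1 :=
  ContinuousLinearMap.opNorm_le_bound _ zero_le_one fun φ => by
    rw [one_mul, norm_royer_apply]

/-- The cross-Wigner transform as a matrix element of the Grossmann–Royer operator. -/
theorem crossWigner_eq_inner {ħ : ℝ} (hħ : 0 < ħ) (φ ψ : L2 ι) (z : ι ⊕ ι → ℝ) :
    crossWigner ħ φ ψ z =
      (((1 / (Real.pi * ħ)) ^ Fintype.card ι : ℝ) : ℂ) * ⟪ψ, royer ħ z φ⟫_ℂ := by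
  set x : ι → ℝ := fun i => z (Sum.inl i) with hx
  set G : (ι → ℝ) → ℂ := fun y => royerPhase ħ z y * φ ((2 : ℝ) • x - y) * conj (ψ y) with hG
  have h1 : ⟪ψ, royer ħ z φ⟫_ℂ = ∫ y, G y := by
    rw [L2.inner_def]
    refine integral_congr_ae ?_
    filter_upwards [royer_coeFn ħ z φ] with y hy
    rw [hy, RCLike.inner_apply]
  -- The substitution `y ↦ x - y/2` has Jacobian factor `2^n`, which turns `(2πħ)^(-n)` into
  -- `(πħ)^(-n)`.
  have h2 : ∫ y : ι → ℝ, G (x - (1 / 2 : ℝ) • y) = (2 : ℂ) ^ Fintype.card ι * ∫ y, G y := by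
    rw [Measure.integral_comp_smul volume (fun y => G (x - y)) (1 / 2 : ℝ),
      integral_sub_left_eq_self G volume x, Module.finrank_fintype_fun_eq_card]
    rw [abs_of_nonneg (by positivity), Complex.real_smul]
    congr 1
    push_cast
    simp
  have h3 : ∀ y : ι → ℝ, Complex.exp (-(Complex.I / (ħ : ℂ)) *
      (((fun i => z (Sum.inr i)) ⬝ᵥ y : ℝ) : ℂ)) *
      φ (x + (1 / 2 : ℝ) • y) * conj (ψ (x - (1 / 2 : ℝ) • y)) = G (x - (1 / 2 : ℝ) • y) := by
    intro y
    have e1 : (2 : ℝ) • x - (x - (1 / 2 : ℝ) • y) = x + (1 / 2 : ℝ) • y := by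
      ext i; simp only [Pi.sub_apply, Pi.smul_apply, Pi.add_apply, smul_eq_mul]; ring
    simp only [hG, e1, royerPhase]
    congr 3
    have e2 : (∑ i, z (Sum.inr i) * ((x - (1 / 2 : ℝ) • y) i - z (Sum.inl i)) : ℝ) =
        -(1 / 2) * ((fun i => z (Sum.inr i)) ⬝ᵥ y) := by
      rw [dotProduct, Finset.mul_sum]
      refine Finset.sum_congr rfl fun i _ => ?_
      simp only [hx, Pi.sub_apply, Pi.smul_apply, smul_eq_mul]; ring
    rw [e2]
    push_cast
    field_simp
  have hc : crossWigner ħ φ ψ z = (((1 / (2 * Real.pi * ħ)) ^ Fintype.card ι : ℝ) : ℂ) *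
      ∫ y : ι → ℝ, G (x - (1 / 2 : ℝ) • y) := by
    rw [← integral_congr_ae (μ := volume) (Filter.Eventually.of_forall h3)]
    rfl
  rw [hc, h2, h1, ← mul_assoc]
  congr 1
  push_cast
  rw [← mul_pow]
  congr 1
  have : (Real.pi : ℂ) ≠ 0 := by exact_mod_cast Real.pi_ne_zero
  have : (ħ : ℂ) ≠ 0 := by exact_mod_cast hħ.ne'
  field_simp

end PhaseOperators

/-! ### Coherent states and the action of reflections on them -/

section CoherentStates

variable {ι : Type} [Fintype ι]

/-- The Gaussian wave function `y ↦ exp (∑ (-y i ^ 2 / 2 + u i * y i))`. -/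
noncomputable def coherentFun (u : ι → ℂ) (y : ι → ℝ) : ℂ :=
  Complex.exp (∑ i, (-(y i : ℂ) ^ 2 / 2 + u i * y i))

theorem continuous_coherentFun (u : ι → ℂ) : Continuous (coherentFun u) := by
  unfold coherentFun
  fun_prop

theorem memLp_coherentFun (u : ι → ℂ) : MemLp (coherentFun u) 2 volume := by
  rw [memLp_two_iff_integrable_sq_norm (continuous_coherentFun u).aestronglyMeasurable]
  refine (integrable_cexp_quadratic_pi (β := fun _ : ι => 1) (fun _ => one_pos)
    (fun i => 2 * u i)).norm.congr (Filter.Eventually.of_forall fun y => ?_)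
  simp only [coherentFun, ← norm_pow, ← Complex.exp_nat_mul, Finset.mul_sum]
  congr 3 with i
  push_cast; ring

/-- The (unnormalized) coherent state with complex parameter `u`. -/
noncomputable def coherent (u : ι → ℂ) : L2 ι := (memLp_coherentFun u).toLp _

theorem coherent_coeFn (u : ι → ℂ) : coherent u =ᵐ[volume] coherentFun u :=
  (memLp_coherentFun u).coeFn_toLp

theorem inner_coherent (v u : ι → ℂ) : ⟪coherent v, coherent u⟫_ℂ =
    ((Real.sqrt Real.pi ^ Fintype.card ι : ℝ) : ℂ) *
      Complex.exp (∑ i, (conj (v i) + u i) ^ 2 / 4) := by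
  rw [L2.inner_def]
  have h := integral_cexp_quadratic_pi (β := fun _ : ι => 1) (fun _ => one_pos)
    (fun i => conj (v i) + u i)
  simp only [div_one, Finset.prod_const, Finset.card_univ, Complex.ofReal_one, mul_one] at h
  rw [← h]
  refine integral_congr_ae ?_
  filter_upwards [coherent_coeFn v, coherent_coeFn u] with y h1 h2
  rw [h1, h2, RCLike.inner_apply]
  simp only [coherentFun, ← Complex.exp_conj, map_sum, map_add, map_mul, map_div₀, map_neg, map_pow,
    Complex.conj_ofReal, Complex.conj_ofNat, ← Complex.exp_add, ← Finset.sum_add_distrib]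
  congr 1
  refine Finset.sum_congr rfl fun i _ => ?_
  ring

/-- Reflecting a Gaussian and multiplying by a plane wave gives a Gaussian of the same width, so
reflections permute coherent states up to scalars and all matrix elements become explicit. The width
does not involve `ħ`, hence momenta enter only as `p / ħ`. -/
theorem royer_coherent (ħ : ℝ) (z : ι ⊕ ι → ℝ) (u : ι → ℂ) :
    royer ħ z (coherent u) =
      Complex.exp (∑ i, (2 * u i * z (Sum.inl i) - 2 * (z (Sum.inl i) : ℂ) ^ 2
        - 2 * Complex.I * (z (Sum.inr i) / ħ) * z (Sum.inl i))) •
      coherent fun i => 2 * (z (Sum.inl i) : ℂ) - u i + 2 * Complex.I * (z (Sum.inr i) / ħ) := by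
  refine Lp.ext ?_
  have hτ := (measurePreserving_reflection (fun i => z (Sum.inl i))).quasiMeasurePreserving
  filter_upwards [royer_coeFn ħ z (coherent u), hτ.ae (coherent_coeFn u), Lp.coeFn_smul
    (Complex.exp (∑ i, (2 * u i * z (Sum.inl i) - 2 * (z (Sum.inl i) : ℂ) ^ 2
        - 2 * Complex.I * (z (Sum.inr i) / ħ) * z (Sum.inl i)))) (coherent fun i =>
      2 * (z (Sum.inl i) : ℂ) - u i + 2 * Complex.I * (z (Sum.inr i) / ħ)),
    coherent_coeFn fun i => 2 * (z (Sum.inl i) : ℂ) - u i + 2 * Complex.I * (z (Sum.inr i) / ħ)]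
    with y h1 h2 h3 h4
  rw [h1, h2, h3, Pi.smul_apply, h4, smul_eq_mul]
  simp only [coherentFun, royerPhase, ← Complex.exp_add, Complex.ofReal_mul, Complex.ofReal_sum,
    Finset.mul_sum, Finset.sum_mul, ← Finset.sum_add_distrib]
  congr 1
  refine Finset.sum_congr rfl fun i _ => ?_
  simp only [Pi.sub_apply, Pi.smul_apply, smul_eq_mul]
  push_cast
  ring

/-- Matrix elements of the Grossmann–Royer operators between coherent states. -/
theorem inner_royer_coherent (ħ : ℝ) (z : ι ⊕ ι → ℝ) (v u : ι → ℂ) :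
    ⟪coherent v, royer ħ z (coherent u)⟫_ℂ =
      ((Real.sqrt Real.pi ^ Fintype.card ι : ℝ) : ℂ) *
      Complex.exp (∑ i, (-(z (Sum.inl i) : ℂ) ^ 2 + (conj (v i) + u i) * z (Sum.inl i)
        - (z (Sum.inr i) / ħ) ^ 2 + Complex.I * (conj (v i) - u i) * (z (Sum.inr i) / ħ)
        + (conj (v i) - u i) ^ 2 / 4)) := by
  rw [royer_coherent, inner_smul_right, inner_coherent, mul_left_comm, ← Complex.exp_add,
    ← Finset.sum_add_distrib]
  congr 2
  refine Finset.sum_congr rfl fun i _ => ?_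
  linear_combination ((z (Sum.inr i) : ℂ) / ħ) ^ 2 * Complex.I_sq

/-- The squared distance of two coherent states expands into inner products, which are explicit
continuous functions of the parameters. -/
theorem continuous_coherent : Continuous (coherent : (ι → ℂ) → L2 ι) := by
  refine continuous_iff_continuousAt.2 fun v => ?_
  rw [ContinuousAt, tendsto_iff_norm_sub_tendsto_zero]
  have h : ∀ u : ι → ℂ, ‖coherent u - coherent v‖ =
      Real.sqrt (‖⟪coherent u, coherent u⟫_ℂ - ⟪coherent u, coherent v⟫_ℂ -
        ⟪coherent v, coherent u⟫_ℂ + ⟪coherent v, coherent v⟫_ℂ‖) := by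
    intro u
    rw [← inner_sub_sub_self, inner_self_eq_norm_sq_to_K]
    simp [Real.sqrt_sq]
  simp only [h, inner_coherent]
  have hc : Continuous fun u : ι → ℂ => Real.sqrt
    (‖((Real.sqrt Real.pi ^ Fintype.card ι : ℝ) : ℂ) *
      Complex.exp (∑ i, (conj (u i) + u i) ^ 2 / 4) -
      ((Real.sqrt Real.pi ^ Fintype.card ι : ℝ) : ℂ) *
      Complex.exp (∑ i, (conj (u i) + v i) ^ 2 / 4) -
      ((Real.sqrt Real.pi ^ Fintype.card ι : ℝ) : ℂ) *
      Complex.exp (∑ i, (conj (v i) + u i) ^ 2 / 4) +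
      ((Real.sqrt Real.pi ^ Fintype.card ι : ℝ) : ℂ) *
      Complex.exp (∑ i, (conj (v i) + v i) ^ 2 / 4)‖) := by fun_prop
  have := hc.tendsto v
  simpa using this

end CoherentStates

/-! ### Injectivity of the Fourier transform on integrable functions -/

section FourierUniqueness

variable {ι : Type} [Fintype ι]

/-- The positive and negative parts of `h` are densities of two finite measures. Vanishing of the
transform says that these have the same characteristic function, so they coincide. -/
theorem ae_eq_zero_of_forall_integral_exp_real {h : (ι → ℝ) → ℝ} (hh : Integrable h)
    (h0 : ∀ t : ι → ℝ, ∫ y, Complex.exp (((∑ i, t i * y i : ℝ) : ℂ) * Complex.I) * (h y : ℂ) = 0) :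
    h =ᵐ[volume] 0 := by
  set μ : Measure (ι → ℝ) := volume.withDensity fun y => ENNReal.ofReal (h y) with hμ
  set ν : Measure (ι → ℝ) := volume.withDensity fun y => ENNReal.ofReal (-h y) with hν
  have : IsFiniteMeasure μ := isFiniteMeasure_withDensity_ofReal hh.2
  have : IsFiniteMeasure ν := isFiniteMeasure_withDensity_ofReal hh.neg.2
  have hden : ∀ (g : (ι → ℝ) → ℝ), Integrable g → ∀ L : StrongDual ℝ (ι → ℝ),
      charFunDual (volume.withDensity fun y => ENNReal.ofReal (g y)) L =
      ∫ y, Complex.exp ((L y : ℂ) * Complex.I) * ((max (g y) 0 : ℝ) : ℂ) := by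
    intro g hg L
    rw [charFunDual_apply, integral_withDensity_eq_integral_toReal_smul₀
      hg.1.aemeasurable.ennreal_ofReal (by simp)]
    refine integral_congr_ae (Filter.Eventually.of_forall fun y => ?_)
    simp [ENNReal.toReal_ofReal', mul_comm]
  have hmul : ∀ (g : (ι → ℝ) → ℝ), Integrable g → ∀ L : StrongDual ℝ (ι → ℝ),
      Integrable fun y => Complex.exp ((L y : ℂ) * Complex.I) * ((max (g y) 0 : ℝ) : ℂ) := by
    intro g hg L
    refine (hg.pos_part.ofReal (𝕜 := ℂ)).bdd_mul (c := 1) ?_ ?_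
    · exact Continuous.aestronglyMeasurable (by fun_prop)
    · exact Filter.Eventually.of_forall fun y => (Complex.norm_exp_ofReal_mul_I _).le
  have hμν : μ = ν := by
    refine Measure.ext_of_charFunDual (funext fun L => ?_)
    rw [hμ, hν, hden h hh L, hden (fun y => -h y) hh.neg L, ← sub_eq_zero,
      ← integral_sub (hmul h hh L) (hmul (fun y => -h y) hh.neg L)]
    classical
    rw [← h0 fun i => L (Pi.single i 1)]
    refine integral_congr_ae (Filter.Eventually.of_forall fun y => ?_)
    have hL : L y = ∑ i, L (Pi.single i 1) * y i := by
      conv_lhs => rw [← Finset.univ_sum_single y]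
      rw [map_sum]
      refine Finset.sum_congr rfl fun i _ => ?_
      rw [mul_comm, ← smul_eq_mul, ← map_smul, ← Pi.single_smul, smul_eq_mul, mul_one]
    simp only [← hL, ← mul_sub, ← Complex.ofReal_sub]
    congr 2
    rcases le_total (h y) 0 with h1 | h1
    · simp [h1]
    · simp [h1]
  have hae := (withDensity_eq_iff_of_sigmaFinite hh.1.aemeasurable.ennreal_ofReal
    hh.neg.1.aemeasurable.ennreal_ofReal).1 hμν
  filter_upwards [hae] with y hy
  simp only [Pi.neg_apply, Pi.zero_apply] at hy ⊢
  rcases lt_trichotomy (h y) 0 with h1 | h1 | h1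
  · rw [ENNReal.ofReal_of_nonpos h1.le, eq_comm, ENNReal.ofReal_eq_zero] at hy; linarith
  · exact h1
  · rw [ENNReal.ofReal_of_nonpos (p := -h y) (by linarith), ENNReal.ofReal_eq_zero] at hy; linarith

/-- An integrable function with vanishing Fourier transform vanishes almost everywhere. -/
theorem ae_eq_zero_of_forall_integral_exp {h : (ι → ℝ) → ℂ} (hh : Integrable h)
    (h0 : ∀ t : ι → ℝ, ∫ y, Complex.exp (((∑ i, t i * y i : ℝ) : ℂ) * Complex.I) * h y = 0) :
    h =ᵐ[volume] 0 := by
  have hint : ∀ t : ι → ℝ,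
      Integrable fun y => Complex.exp (((∑ i, t i * y i : ℝ) : ℂ) * Complex.I) * h y := by
    intro t
    refine hh.bdd_mul (c := 1) ?_ ?_
    · exact Continuous.aestronglyMeasurable (by fun_prop)
    · exact Filter.Eventually.of_forall fun y => (Complex.norm_exp_ofReal_mul_I _).le
  -- Conjugation replaces `t` by `-t`, so the transforms of `conj h`, and then of the real and
  -- imaginary parts, vanish as well.
  have hconj : ∀ (t : ι → ℝ) y, Complex.exp (((∑ i, t i * y i : ℝ) : ℂ) * Complex.I) * conj (h y) =
      conj (Complex.exp (((∑ i, (-t) i * y i : ℝ) : ℂ) * Complex.I) * h y) := by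
    intro t y
    rw [map_mul, ← Complex.exp_conj, map_mul, Complex.conj_ofReal, Complex.conj_I]
    simp
  have h0c : ∀ t : ι → ℝ,
      ∫ y, Complex.exp (((∑ i, t i * y i : ℝ) : ℂ) * Complex.I) * conj (h y) = 0 := by
    intro t
    simp only [hconj]
    rw [integral_conj, h0, map_zero]
  have hintc : ∀ t : ι → ℝ,
      Integrable fun y => Complex.exp (((∑ i, t i * y i : ℝ) : ℂ) * Complex.I) * conj (h y) := by
    intro t
    simp only [hconj]
    exact Complex.conjCLE.toContinuousLinearMap.integrable_comp (hint (-t))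
  have hre := ae_eq_zero_of_forall_integral_exp_real hh.re fun t => by
    have e : ∀ y, Complex.exp (((∑ i, t i * y i : ℝ) : ℂ) * Complex.I) * ((RCLike.re (h y) : ℝ) : ℂ)
        = (1 / 2 : ℂ) * (Complex.exp (((∑ i, t i * y i : ℝ) : ℂ) * Complex.I) * h y +
          Complex.exp (((∑ i, t i * y i : ℝ) : ℂ) * Complex.I) * conj (h y)) := fun y => by
      rw [← mul_add, Complex.add_conj]; simp; ring
    simp only [e]
    rw [integral_const_mul, integral_add (hint t) (hintc t), h0, h0c]; simp
  have him := ae_eq_zero_of_forall_integral_exp_real hh.im fun t => by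
    have e : ∀ y, Complex.exp (((∑ i, t i * y i : ℝ) : ℂ) * Complex.I) * ((RCLike.im (h y) : ℝ) : ℂ)
        = (-Complex.I / 2 : ℂ) * (Complex.exp (((∑ i, t i * y i : ℝ) : ℂ) * Complex.I) * h y -
          Complex.exp (((∑ i, t i * y i : ℝ) : ℂ) * Complex.I) * conj (h y)) := fun y => by
      rw [← mul_sub, Complex.sub_conj]
      simp only [RCLike.im_to_complex]
      push_cast
      linear_combination (Complex.exp ((∑ i, (t i : ℂ) * y i) * Complex.I) * (h y).im) * Complex.I_sq
    simp only [e]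
    rw [integral_const_mul, integral_sub (hint t) (hintc t), h0, h0c]; simp
  filter_upwards [hre, him] with y h1 h2
  exact Complex.ext h1 h2

end FourierUniqueness

/-! ### Totality of coherent states and the Moyal identity -/

section Moyal

variable {ι : Type} [Fintype ι]

/-- For purely imaginary `u` the inner product is the Fourier transform of `f` times a fixed
Gaussian, and that Gaussian has no zero. -/
theorem eq_zero_of_forall_inner_coherent {f : L2 ι} (hf : ∀ u : ι → ℂ, ⟪coherent u, f⟫_ℂ = 0) :
    f = 0 := by
  have hinner : ∀ u : ι → ℂ, ⟪coherent u, f⟫_ℂ = ∫ y, conj (coherentFun u y) * f y := by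
    intro u
    rw [L2.inner_def]
    refine integral_congr_ae ?_
    filter_upwards [coherent_coeFn u] with y h1
    rw [h1, RCLike.inner_apply, mul_comm]
  have hint : Integrable fun y => conj (coherentFun 0 y) * f y := by
    refine (L2.integrable_inner (𝕜 := ℂ) (coherent 0) f).congr ?_
    filter_upwards [coherent_coeFn 0] with y h1
    rw [h1, RCLike.inner_apply, mul_comm]
  have h := ae_eq_zero_of_forall_integral_exp hint fun t => by
    rw [← hf fun i => -(t i : ℂ) * Complex.I, hinner]
    refine integral_congr_ae (Filter.Eventually.of_forall fun y => ?_)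
    simp only [coherentFun, ← Complex.exp_conj, ← mul_assoc, ← Complex.exp_add]
    congr 2
    simp only [map_sum, map_add, map_mul, map_neg, map_pow, map_div₀, Complex.conj_ofReal,
      Complex.conj_I, Complex.conj_ofNat, Complex.ofReal_sum, Complex.ofReal_mul, Finset.sum_mul,
      ← Finset.sum_add_distrib, Pi.zero_apply, map_zero]
    exact Finset.sum_congr rfl fun i _ => by ring
  refine Lp.ext ?_
  filter_upwards [h, Lp.coeFn_zero ℂ 2 (volume : Measure (ι → ℝ))] with y h1 h2
  rw [h2]
  have : conj (coherentFun 0 y) ≠ 0 := by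
    simp [coherentFun, Complex.exp_ne_zero]
  exact (mul_eq_zero.1 h1).resolve_left this

theorem dense_span_coherent :
    Dense (Submodule.span ℂ (Set.range (coherent : (ι → ℂ) → L2 ι)) : Set (L2 ι)) :=
  dense_span_of_forall_inner_eq_zero fun _ hf =>
    eq_zero_of_forall_inner_coherent fun u => hf _ ⟨u, rfl⟩

/-- The reflections are uniformly bounded, so strong continuity need only be checked on coherent
states, where the action is explicit. -/
theorem continuous_royer_apply (ħ : ℝ) (φ : L2 ι) : Continuous fun z => royer ħ z φ := by
  refine continuous_apply_of_dense_span dense_span_coherent (norm_royer_le ħ) ?_ φ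
  rintro _ ⟨u, rfl⟩
  simp only [royer_coherent]
  have h1 : Continuous fun z : ι ⊕ ι → ℝ => (fun i => 2 * (z (Sum.inl i) : ℂ) - u i +
      2 * Complex.I * (z (Sum.inr i) / ħ) : ι → ℂ) := by fun_prop
  have h2 : Continuous fun z : ι ⊕ ι → ℝ =>
      Complex.exp (∑ i, (2 * u i * z (Sum.inl i) - 2 * (z (Sum.inl i) : ℂ) ^ 2
        - 2 * Complex.I * (z (Sum.inr i) / ħ) * z (Sum.inl i))) := by fun_prop
  exact h2.smul (continuous_coherent.comp h1)

theorem integrable_inner_royer_coherent {ħ : ℝ} (hħ : 0 < ħ) (v u : ι → ℂ) :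
    Integrable fun z : ι ⊕ ι → ℝ => ⟪coherent v, royer ħ z (coherent u)⟫_ℂ := by
  have h := integrable_cexp_quadratic_pi
    (β := Sum.elim (fun _ : ι => (1 : ℝ)) (fun _ : ι => 1 / ħ ^ 2))
    (by rintro (i | i) <;> simp only [Sum.elim_inl, Sum.elim_inr] <;> positivity)
    (Sum.elim (fun i => conj (v i) + u i) (fun i => Complex.I * (conj (v i) - u i) / ħ))
  refine (h.const_mul (((Real.sqrt Real.pi ^ Fintype.card ι : ℝ) : ℂ) *
    Complex.exp (∑ i, (conj (v i) - u i) ^ 2 / 4))).congr (Filter.Eventually.of_forall fun z => ?_)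
  simp only [inner_royer_coherent, mul_assoc, ← Complex.exp_add, Fintype.sum_sum_type,
    Sum.elim_inl, Sum.elim_inr, ← Finset.sum_add_distrib]
  congr 2
  refine Finset.sum_congr rfl fun i _ => ?_
  push_cast
  ring

/-- The Moyal identity for coherent states. -/
theorem integral_inner_royer_coherent_mul {ħ : ℝ} (hħ : 0 < ħ) (v u s t : ι → ℂ) :
    ∫ z : ι ⊕ ι → ℝ, ⟪coherent v, royer ħ z (coherent u)⟫_ℂ *
        ⟪coherent s, royer ħ z (coherent t)⟫_ℂ =
      (((Real.pi * ħ / 2) ^ Fintype.card ι : ℝ) : ℂ) *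
        (⟪coherent s, coherent u⟫_ℂ * ⟪coherent v, coherent t⟫_ℂ) := by
  have h := integral_cexp_quadratic_pi
    (β := Sum.elim (fun _ : ι => (2 : ℝ)) (fun _ : ι => 2 / ħ ^ 2))
    (by rintro (i | i) <;> simp only [Sum.elim_inl, Sum.elim_inr] <;> positivity)
    (Sum.elim (fun i => conj (v i) + u i + conj (s i) + t i)
      (fun i => Complex.I * (conj (v i) - u i + conj (s i) - t i) / ħ))
  set C : ℂ := ((Real.sqrt Real.pi ^ Fintype.card ι : ℝ) : ℂ) with hC
  have e : ∀ z : ι ⊕ ι → ℝ, ⟪coherent v, royer ħ z (coherent u)⟫_ℂ *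
      ⟪coherent s, royer ħ z (coherent t)⟫_ℂ = (C * C * Complex.exp
        (∑ i, ((conj (v i) - u i) ^ 2 / 4 + (conj (s i) - t i) ^ 2 / 4))) * Complex.exp (∑ j,
      (-((Sum.elim (fun _ : ι => (2 : ℝ)) (fun _ : ι => 2 / ħ ^ 2) j : ℝ) : ℂ) * (z j : ℂ) ^ 2 +
        Sum.elim (fun i => conj (v i) + u i + conj (s i) + t i)
      (fun i => Complex.I * (conj (v i) - u i + conj (s i) - t i) / ħ) j * z j)) := by
    intro z
    rw [inner_royer_coherent, inner_royer_coherent, ← hC, mul_mul_mul_comm, ← Complex.exp_add,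
      mul_assoc _ (Complex.exp _), ← Complex.exp_add, Fintype.sum_sum_type]
    simp only [Sum.elim_inl, Sum.elim_inr, ← Finset.sum_add_distrib]
    congr 2
    refine Finset.sum_congr rfl fun i _ => ?_
    push_cast
    ring
  simp only [e]
  have hħ' : (ħ : ℂ) ≠ 0 := by exact_mod_cast hħ.ne'
  -- Each pair of a position and a momentum contributes `√(π/2) · √(πħ²/2) = πħ/2`.
  have hconst : ((∏ j, Real.sqrt (Real.pi / Sum.elim (fun _ : ι => (2 : ℝ))
      (fun _ : ι => 2 / ħ ^ 2) j) : ℝ) : ℂ) = (((Real.pi * ħ / 2) ^ Fintype.card ι : ℝ) : ℂ) := by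
    rw [Fintype.prod_sum_type]
    simp only [Sum.elim_inl, Sum.elim_inr, Finset.prod_const, Finset.card_univ, ← mul_pow]
    congr 2
    rw [← Real.sqrt_mul (by positivity)]
    rw [show Real.pi / 2 * (Real.pi / (2 / ħ ^ 2)) = (Real.pi * ħ / 2) ^ 2 by field_simp]
    exact Real.sqrt_sq (by positivity)
  -- Completing the squares re-pairs the parameters: `(v, u), (s, t)` becomes `(s, u), (v, t)`.
  have key : Complex.exp (∑ i, ((conj (v i) - u i) ^ 2 / 4 + (conj (s i) - t i) ^ 2 / 4)) *
      Complex.exp (∑ j, (Sum.elim (fun i => conj (v i) + u i + conj (s i) + t i)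
        (fun i => Complex.I * (conj (v i) - u i + conj (s i) - t i) / ħ)) j ^ 2 /
        (4 * ((Sum.elim (fun _ : ι => (2 : ℝ)) (fun _ : ι => 2 / ħ ^ 2) j : ℝ) : ℂ))) =
      Complex.exp (∑ i, (conj (s i) + u i) ^ 2 / 4) *
        Complex.exp (∑ i, (conj (v i) + t i) ^ 2 / 4) := by
    rw [← Complex.exp_add, ← Complex.exp_add, Fintype.sum_sum_type]
    simp only [Sum.elim_inl, Sum.elim_inr, ← Finset.sum_add_distrib]
    congr 1
    refine Finset.sum_congr rfl fun i _ => ?_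
    push_cast
    field_simp
    rw [Complex.I_sq]
    ring
  rw [integral_const_mul, h, inner_coherent, inner_coherent, ← hC, hconst]
  linear_combination (C * C * (((Real.pi * ħ / 2) ^ Fintype.card ι : ℝ) : ℂ)) * key

end Moyal

/-! ### Countability of Hilbert bases -/

section CountableBasis

variable {H : Type} [NormedAddCommGroup H] [InnerProductSpace ℂ H]

/-- Distinct basis vectors are `√2` apart, so balls of radius `1/2` around them are disjoint.
Countability is needed to integrate traces term by term. -/
theorem HilbertBasis.countable_index [TopologicalSpace.SeparableSpace H] {J : Type}
    (b : HilbertBasis J ℂ H) : Countable J := by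
  refine Pairwise.countable_of_isOpen_disjoint (s := fun j => Metric.ball (b j) (1 / 2)) ?_
    (fun _ => Metric.isOpen_ball) (fun j => ⟨b j, Metric.mem_ball_self (by norm_num)⟩)
  intro i j hij
  refine Metric.ball_disjoint_ball ?_
  have h : ‖b i - b j‖ ^ 2 = 2 := by
    rw [@norm_sub_sq ℂ, b.orthonormal.2 hij, b.orthonormal.1, b.orthonormal.1]
    norm_num
  rw [dist_eq_norm]
  nlinarith [norm_nonneg (b i - b j)]

end CountableBasis

/-! ### Recovering an operator and its purity from its Wigner function -/

section Reconstruction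

open scoped InnerProduct

theorem inner_apply_left_eq_right {H : Type} [NormedAddCommGroup H] [InnerProductSpace ℂ H]
    [CompleteSpace H] {S : H →L[ℂ] H} (hS : S† = S) (x y : H) : ⟪S x, y⟫_ℂ = ⟪x, S y⟫_ℂ := by
  rw [← ContinuousLinearMap.adjoint_inner_left, hS]

variable {ι : Type} [Fintype ι]

instance : TopologicalSpace.SeparableSpace (L2 ι) := by
  have : Fact ((2 : ENNReal) ≠ ⊤) := ⟨by norm_num⟩
  have : SecondCountableTopology (L2 ι) := Lp.SecondCountableTopology
  infer_instance

/-- In operator form, `∫ ⟪v, R(z) u⟫ R(z) dz = (πħ/2)^n |u⟩⟨v|`. One pair stays coherent so that the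
weight is integrable; the other pair becomes arbitrary by density. -/
theorem integral_inner_royer_mul {ħ : ℝ} (hħ : 0 < ħ) (v u : ι → ℂ) (a a' : L2 ι) :
    ∫ z : ι ⊕ ι → ℝ, ⟪coherent v, royer ħ z (coherent u)⟫_ℂ * ⟪a, royer ħ z a'⟫_ℂ =
      (((Real.pi * ħ / 2) ^ Fintype.card ι : ℝ) : ℂ) *
        (⟪a, coherent u⟫_ℂ * ⟪coherent v, a'⟫_ℂ) := by
  have h := integral_inner_eq_of_dense_span dense_span_coherent (norm_royer_le ħ)
    (continuous_royer_apply ħ) (integrable_inner_royer_coherent hħ v u)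
    ((((Real.pi * ħ / 2) ^ Fintype.card ι : ℝ) : ℂ) •
      (innerSL ℂ (coherent v)).smulRight (coherent u)) ?_ a a'
  · rw [h]
    simp only [smul_apply, ContinuousLinearMap.smulRight_apply, innerSL_apply_apply,
      inner_smul_right]
    ring
  · rintro _ ⟨s, rfl⟩ _ ⟨t, rfl⟩
    rw [integral_inner_royer_coherent_mul hħ]
    simp only [smul_apply, ContinuousLinearMap.smulRight_apply, innerSL_apply_apply,
      inner_smul_right]
    ring

section TermwiseIntegration

set_option linter.unusedSectionVars false

variable {H : Type} [NormedAddCommGroup H] [InnerProductSpace ℂ H]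
  {Ω : Type} [TopologicalSpace Ω] [MeasurableSpace Ω] [OpensMeasurableSpace Ω]
  [SecondCountableTopology Ω] [TopologicalSpace.PseudoMetrizableSpace Ω] {μ : Measure Ω}

theorem norm_inner_apply_le {Y : H →L[ℂ] H} (hY : ‖Y‖ ≤ 1) (a a' : H) :
    ‖⟪a, Y a'⟫_ℂ‖ ≤ ‖a‖ * ‖a'‖ :=
  (norm_inner_le_norm _ _).trans
    (mul_le_mul_of_nonneg_left (by simpa using Y.le_of_opNorm_le hY a') (norm_nonneg _))

theorem integrable_mul_inner_apply {Y : Ω → H →L[ℂ] H} (hY1 : ∀ w, ‖Y w‖ ≤ 1)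
    (hY : ∀ a, Continuous fun w => Y w a) {f : Ω → ℂ} (hf : Integrable f μ) (a a' : H) :
    Integrable (fun w => f w * ⟪a, Y w a'⟫_ℂ) μ :=
  hf.mul_bdd (c := ‖a‖ * ‖a'‖) (continuous_const.inner (hY a')).aestronglyMeasurable
    (Filter.Eventually.of_forall fun w => norm_inner_apply_le (hY1 w) a a')

/-- Term by term integration of a trace `∑ ⟨a j, Y(w) a j⟩` with `∑ ‖a j‖ ^ 2` finite. -/
theorem hasSum_integral_mul_inner_apply {Y : Ω → H →L[ℂ] H} (hY1 : ∀ w, ‖Y w‖ ≤ 1)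
    (hY : ∀ a, Continuous fun w => Y w a) {J : Type} [Countable J] {a : J → H}
    (ha : Summable fun j => ‖a j‖ ^ 2) {F : Ω → ℂ}
    (hF : ∀ w, HasSum (fun j => ⟪a j, Y w (a j)⟫_ℂ) (F w)) {f : Ω → ℂ} (hf : Integrable f μ) :
    HasSum (fun j => ∫ w, f w * ⟪a j, Y w (a j)⟫_ℂ ∂μ) (∫ w, f w * F w ∂μ) := by
  have h := hasSum_integral_of_summable_integral_norm
    (F := fun j w => f w * ⟪a j, Y w (a j)⟫_ℂ) (μ := μ)
    (fun j => integrable_mul_inner_apply hY1 hY hf _ _) ?_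
  · simpa only [((hF _).mul_left _).tsum_eq] using h
  · refine Summable.of_nonneg_of_le (fun j => integral_nonneg fun _ => norm_nonneg _) (fun j => ?_)
      (ha.mul_left (∫ w, ‖f w‖ ∂μ))
    rw [← integral_mul_const]
    refine integral_mono (integrable_mul_inner_apply hY1 hY hf _ _).norm (hf.norm.mul_const _)
      fun w => ?_
    simp only [norm_mul]
    gcongr
    rw [sq]
    exact norm_inner_apply_le (hY1 w) _ _

end TermwiseIntegration

/-- A trace class operator is the weak integral of its Wigner transform against the
Grossmann–Royer operators. -/
theorem integral_trace_mul_inner_royer {ħ : ℝ} (hħ : 0 < ħ) {S : L2 ι →L[ℂ] L2 ι} (hS : S† = S)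
    (hHS : IsHilbertSchmidt S) {w : (ι ⊕ ι → ℝ) → ℂ} (hwi : Integrable w)
    (hw : ∀ z, HasTrace ((S ∘L S) ∘L royer ħ z) (w z)) (a a' : L2 ι) :
    ∫ z, w z * ⟪a, royer ħ z a'⟫_ℂ =
      (((Real.pi * ħ / 2) ^ Fintype.card ι : ℝ) : ℂ) * ⟪a, S (S a')⟫_ℂ := by
  obtain ⟨J, b, -⟩ := exists_hilbertBasis ℂ (L2 ι)
  have := b.countable_index
  have hsum : ∀ z, HasSum (fun j => ⟪S (b j), royer ħ z (S (b j))⟫_ℂ) (w z) := fun z => by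
    obtain ⟨t, h1, -, h3⟩ := exists_hasTrace_sandwich hS hHS (royer ħ z)
    rw [(hw z).unique h1]
    exact h3 _ b
  have h := integral_inner_eq_of_dense_span dense_span_coherent (norm_royer_le ħ)
    (continuous_royer_apply ħ) hwi
    ((((Real.pi * ħ / 2) ^ Fintype.card ι : ℝ) : ℂ) • (S ∘L S)) ?_ a a'
  · rw [h]
    simp only [smul_apply, ContinuousLinearMap.comp_apply, inner_smul_right]
  · rintro _ ⟨v, rfl⟩ _ ⟨u, rfl⟩
    -- The trace is integrated term by term against the weight `⟪v, R(z) u⟫`. The Moyal identity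
    -- splits each term into two inner products, and expansion in `b` sums them to `⟪S v, S u⟫`.
    have h1 := hasSum_integral_mul_inner_apply (norm_royer_le ħ) (continuous_royer_apply ħ) (hHS _ b)
      hsum (integrable_inner_royer_coherent hħ v u)
    simp only [integral_inner_royer_mul hħ] at h1
    have h2 : HasSum (fun j => (((Real.pi * ħ / 2) ^ Fintype.card ι : ℝ) : ℂ) *
        (⟪S (b j), coherent u⟫_ℂ * ⟪coherent v, S (b j)⟫_ℂ))
        ((((Real.pi * ħ / 2) ^ Fintype.card ι : ℝ) : ℂ) * ⟪S (coherent v), S (coherent u)⟫_ℂ) := by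
      have h3 := (b.hasSum_inner_mul_inner (S (coherent v)) (S (coherent u))).mul_left
        (((Real.pi * ħ / 2) ^ Fintype.card ι : ℝ) : ℂ)
      refine Eq.subst (motive := fun f => HasSum f _) (funext fun j => ?_) h3
      rw [inner_apply_left_eq_right hS, inner_apply_left_eq_right hS, mul_comm ⟪b j, _⟫_ℂ]
    simp only [mul_comm (w _)]
    rw [h1.unique h2]
    simp only [smul_apply, ContinuousLinearMap.comp_apply, inner_smul_right]
    rw [inner_apply_left_eq_right hS]

/-- The purity of a state as the integral of the square of its Wigner transform. -/
theorem hasTrace_sq {ħ : ℝ} (hħ : 0 < ħ) {S : L2 ι →L[ℂ] L2 ι} (hS : S† = S)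
    (hHS : IsHilbertSchmidt S) {w : (ι ⊕ ι → ℝ) → ℂ} (hwi : Integrable w)
    (hw : ∀ z, HasTrace ((S ∘L S) ∘L royer ħ z) (w z)) :
    HasTrace ((S ∘L S) ∘L (S ∘L S))
      ((((2 / (Real.pi * ħ)) ^ Fintype.card ι : ℝ) : ℂ) * ∫ z, w z * w z) := by
  obtain ⟨J, b, -⟩ := exists_hilbertBasis ℂ (L2 ι)
  have := b.countable_index
  have hsum : ∀ z, HasSum (fun j => ⟪S (b j), royer ħ z (S (b j))⟫_ℂ) (w z) := fun z => by
    obtain ⟨t, h1, -, h3⟩ := exists_hasTrace_sandwich hS hHS (royer ħ z)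
    rw [(hw z).unique h1]
    exact h3 _ b
  obtain ⟨t, h1, -, h3⟩ := exists_hasTrace_sandwich hS hHS (S ∘L S)
  -- One factor `w` is expanded as a trace and the other serves as weight. Reconstruction then turns
  -- each term into a diagonal element for `Tr (S (S S) S)`.
  have h4 := hasSum_integral_mul_inner_apply (norm_royer_le ħ) (continuous_royer_apply ħ) (hHS _ b) hsum
    hwi
  simp only [integral_trace_mul_inner_royer hħ hS hHS hwi hw] at h4
  have h5 := ((h3 _ b).mul_left (((Real.pi * ħ / 2) ^ Fintype.card ι : ℝ) : ℂ)).unique h4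
  rw [← h5, ← mul_assoc, ← Complex.ofReal_mul, ← mul_pow]
  have hc : 2 / (Real.pi * ħ) * (Real.pi * ħ / 2) = 1 := by
    have := Real.pi_pos
    field_simp
  rw [hc, one_pow, Complex.ofReal_one, one_mul]
  exact h1

end Reconstruction

/-! ### Tensor products of wave functions -/

section TensorProducts

open scoped InnerProduct

variable {α β : Type} [Fintype α] [Fintype β]

theorem measurePreserving_sumPi : MeasurePreserving
    (MeasurableEquiv.sumPiEquivProdPi fun _ : α ⊕ β => ℝ) volume volume :=
  volume_measurePreserving_sumPiEquivProdPi fun _ => ℝ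

theorem quasiMeasurePreserving_inl : Measure.QuasiMeasurePreserving
    (fun (x : α ⊕ β → ℝ) (i : α) => x (Sum.inl i)) volume volume :=
  Measure.quasiMeasurePreserving_fst.comp
    (measurePreserving_sumPi (α := α) (β := β)).quasiMeasurePreserving

theorem quasiMeasurePreserving_inr : Measure.QuasiMeasurePreserving
    (fun (x : α ⊕ β → ℝ) (i : β) => x (Sum.inr i)) volume volume :=
  Measure.quasiMeasurePreserving_snd.comp
    (measurePreserving_sumPi (α := α) (β := β)).quasiMeasurePreserving

theorem tensor_coeFn (φ : L2 α) (ψ : L2 β) : tensor φ ψ =ᵐ[volume]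
    fun x => φ (fun i => x (Sum.inl i)) * ψ (fun i => x (Sum.inr i)) :=
  (memLp_tensor φ ψ).coeFn_toLp

theorem tensor_add_left (φ φ' : L2 α) (ψ : L2 β) :
    tensor (φ + φ') ψ = tensor φ ψ + tensor φ' ψ := by
  refine Lp.ext ?_
  filter_upwards [tensor_coeFn (φ + φ') ψ, tensor_coeFn φ ψ, tensor_coeFn φ' ψ,
    Lp.coeFn_add (tensor φ ψ) (tensor φ' ψ),
    quasiMeasurePreserving_inl.ae (Lp.coeFn_add φ φ')] with x h1 h2 h3 h4 h5
  rw [h1, h4, Pi.add_apply, h2, h3, h5, Pi.add_apply, add_mul]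

theorem tensor_add_right (φ : L2 α) (ψ ψ' : L2 β) :
    tensor φ (ψ + ψ') = tensor φ ψ + tensor φ ψ' := by
  refine Lp.ext ?_
  filter_upwards [tensor_coeFn φ (ψ + ψ'), tensor_coeFn φ ψ, tensor_coeFn φ ψ',
    Lp.coeFn_add (tensor φ ψ) (tensor φ ψ'),
    quasiMeasurePreserving_inr.ae (Lp.coeFn_add ψ ψ')] with x h1 h2 h3 h4 h5
  rw [h1, h4, Pi.add_apply, h2, h3, h5, Pi.add_apply, mul_add]

theorem tensor_smul_left (c : ℂ) (φ : L2 α) (ψ : L2 β) :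
    tensor (c • φ) ψ = c • tensor φ ψ := by
  refine Lp.ext ?_
  filter_upwards [tensor_coeFn (c • φ) ψ, tensor_coeFn φ ψ, Lp.coeFn_smul c (tensor φ ψ),
    quasiMeasurePreserving_inl.ae (Lp.coeFn_smul c φ)] with x h1 h2 h4 h5
  rw [h1, h4, Pi.smul_apply, h2, h5, Pi.smul_apply, smul_eq_mul, smul_eq_mul, mul_assoc]

theorem tensor_smul_right (c : ℂ) (φ : L2 α) (ψ : L2 β) :
    tensor φ (c • ψ) = c • tensor φ ψ := by
  refine Lp.ext ?_
  filter_upwards [tensor_coeFn φ (c • ψ), tensor_coeFn φ ψ, Lp.coeFn_smul c (tensor φ ψ),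
    quasiMeasurePreserving_inr.ae (Lp.coeFn_smul c ψ)] with x h1 h2 h4 h5
  rw [h1, h4, Pi.smul_apply, h2, h5, Pi.smul_apply, smul_eq_mul, smul_eq_mul, mul_left_comm]

theorem inner_tensor (φ φ' : L2 α) (ψ ψ' : L2 β) :
    ⟪tensor φ ψ, tensor φ' ψ'⟫_ℂ = ⟪φ, φ'⟫_ℂ * ⟪ψ, ψ'⟫_ℂ := by
  simp only [L2.inner_def]
  rw [← integral_prod_mul, ← Measure.volume_eq_prod,
    ← (measurePreserving_sumPi (α := α) (β := β)).integral_comp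
      (MeasurableEquiv.measurableEmbedding _)]
  refine integral_congr_ae ?_
  filter_upwards [tensor_coeFn φ ψ, tensor_coeFn φ' ψ'] with x h1 h2
  rw [h1, h2]
  simp only [RCLike.inner_apply, map_mul]
  exact mul_mul_mul_comm _ _ _ _

theorem norm_tensor (φ : L2 α) (ψ : L2 β) : ‖tensor φ ψ‖ = ‖φ‖ * ‖ψ‖ := by
  have h := inner_tensor φ φ ψ ψ
  simp only [inner_self_eq_norm_sq_to_K, ← mul_pow] at h
  have h' : ‖tensor φ ψ‖ ^ 2 = (‖φ‖ * ‖ψ‖) ^ 2 := by exact_mod_cast h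
  exact (sq_eq_sq₀ (norm_nonneg _) (by positivity)).1 h'

/-- `ψ ↦ φ ⊗ ψ` as a bounded operator. -/
noncomputable def tensorLeft (φ : L2 α) : L2 β →L[ℂ] L2 (α ⊕ β) :=
  LinearMap.mkContinuous
    { toFun := fun ψ => tensor φ ψ
      map_add' := tensor_add_right φ
      map_smul' := fun c ψ => tensor_smul_right c φ ψ } ‖φ‖ fun ψ => (norm_tensor φ ψ).le

/-- `φ ↦ φ ⊗ ψ` as a bounded operator. -/
noncomputable def tensorRight (ψ : L2 β) : L2 α →L[ℂ] L2 (α ⊕ β) :=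
  LinearMap.mkContinuous
    { toFun := fun φ => tensor φ ψ
      map_add' := fun φ φ' => tensor_add_left φ φ' ψ
      map_smul' := fun c φ => tensor_smul_left c φ ψ } ‖ψ‖
    fun φ => (norm_tensor φ ψ).le.trans (mul_comm _ _).le

@[simp]
theorem tensorLeft_apply (φ : L2 α) (ψ : L2 β) : tensorLeft φ ψ = tensor φ ψ := rfl

@[simp]
theorem tensorRight_apply (φ : L2 α) (ψ : L2 β) : tensorRight ψ φ = tensor φ ψ := rfl

theorem adjoint_tensorLeft_tensor (φ φ' : L2 α) (ψ : L2 β) :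
    ((tensorLeft φ)†) (tensor φ' ψ) = ⟪φ, φ'⟫_ℂ • ψ := by
  refine ext_inner_left ℂ fun v => ?_
  rw [ContinuousLinearMap.adjoint_inner_right, tensorLeft_apply, inner_tensor, inner_smul_right]

theorem adjoint_tensorRight_tensor (φ : L2 α) (ψ ψ' : L2 β) :
    ((tensorRight ψ)†) (tensor φ ψ') = ⟪ψ, ψ'⟫_ℂ • φ := by
  refine ext_inner_left ℂ fun v => ?_
  rw [ContinuousLinearMap.adjoint_inner_right, tensorRight_apply, inner_tensor, inner_smul_right,
    mul_comm]

theorem tensor_coherent (u : α → ℂ) (v : β → ℂ) :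
    tensor (coherent u) (coherent v) = coherent (Sum.elim u v) := by
  refine Lp.ext ?_
  filter_upwards [tensor_coeFn (coherent u) (coherent v), coherent_coeFn (Sum.elim u v),
    quasiMeasurePreserving_inl.ae (coherent_coeFn u),
    quasiMeasurePreserving_inr.ae (coherent_coeFn v)] with x h1 h2 h3 h4
  rw [h1, h2, h3, h4]
  simp [coherentFun, ← Complex.exp_add, Fintype.sum_sum_type]

/-- A total set in `L²(ℝ^(α ⊕ β))`. -/
theorem dense_span_tensor_coherent : Dense (Submodule.span ℂ
    (Set.range fun p : (α → ℂ) × (β → ℂ) => tensor (coherent p.1) (coherent p.2)) :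
      Set (L2 (α ⊕ β))) := by
  refine dense_span_of_forall_inner_eq_zero fun f hf =>
    eq_zero_of_forall_inner_coherent fun u => ?_
  have := hf _ ⟨(fun i => u (Sum.inl i), fun i => u (Sum.inr i)), rfl⟩
  dsimp only at this
  rwa [tensor_coherent, show Sum.elim (fun i => u (Sum.inl i)) (fun i => u (Sum.inr i)) = u from
    Sum.elim_comp_inl_inr u] at this

theorem exists_tensorBasis {J K : Type} (b : HilbertBasis J ℂ (L2 α))
    (c : HilbertBasis K ℂ (L2 β)) : ∃ e : HilbertBasis (J × K) ℂ (L2 (α ⊕ β)),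
      ∀ p, e p = tensor (b p.1) (c p.2) := by
  have ho : Orthonormal ℂ fun p : J × K => tensor (b p.1) (c p.2) := by
    classical
    rw [orthonormal_iff_ite]
    rintro ⟨j, k⟩ ⟨j', k'⟩
    rw [inner_tensor, orthonormal_iff_ite.1 b.orthonormal, orthonormal_iff_ite.1 c.orthonormal]
    by_cases h1 : j = j' <;> by_cases h2 : k = k' <;> simp [h1, h2]
  refine ⟨HilbertBasis.mkOfOrthogonalEqBot ho ?_, fun p => by
    rw [HilbertBasis.coe_mkOfOrthogonalEqBot]⟩
  rw [Submodule.eq_bot_iff]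
  intro f hf
  have h1 : ∀ j k, ⟪tensor (b j) (c k), f⟫_ℂ = 0 := fun j k =>
    (Submodule.mem_orthogonal _ _).1 hf _ (Submodule.subset_span ⟨(j, k), rfl⟩)
  -- Orthogonality to the products `b j ⊗ c k` extends to all tensors one factor at a time, since a
  -- slice of `f` with vanishing coordinates is zero.
  have h2 : ∀ j ψ, ⟪tensor (b j) ψ, f⟫_ℂ = 0 := by
    intro j ψ
    have : ((tensorLeft (b j))†) f = 0 := by
      refine c.repr.injective (lp.ext (funext fun k => ?_))
      rw [c.repr_apply_apply, ContinuousLinearMap.adjoint_inner_right, tensorLeft_apply, h1,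
        map_zero]
      rfl
    rw [← tensorLeft_apply, ← ContinuousLinearMap.adjoint_inner_right, this, inner_zero_right]
  have h3 : ∀ φ ψ, ⟪tensor φ ψ, f⟫_ℂ = 0 := by
    intro φ ψ
    have : ((tensorRight ψ)†) f = 0 := by
      refine b.repr.injective (lp.ext (funext fun j => ?_))
      rw [b.repr_apply_apply, ContinuousLinearMap.adjoint_inner_right, tensorRight_apply, h2,
        map_zero]
      rfl
    rw [← tensorRight_apply, ← ContinuousLinearMap.adjoint_inner_right, this, inner_zero_right]
  refine eq_zero_of_forall_inner_coherent fun u => ?_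
  rw [← Sum.elim_comp_inl_inr u, ← tensor_coherent, h3]

end TensorProducts

/-! ### Existence and uniqueness of the partial trace -/

section ReducedState

open scoped InnerProduct

variable {α β : Type} [Fintype α] [Fintype β]

/-- Slicing off `ψ` and then tensoring with `φ` realizes `|φ⟩⟨ψ| ⊗ I`. -/
theorem isTensorId_rankOne (φ ψ : L2 α) :
    IsTensorId ((innerSL ℂ ψ).smulRight φ)
      (tensorLeft φ ∘L (tensorLeft (β := β) ψ)†) := fun f g => by
  rw [ContinuousLinearMap.comp_apply, adjoint_tensorLeft_tensor, map_smul, tensorLeft_apply,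
    ContinuousLinearMap.smulRight_apply, innerSL_apply_apply, tensor_smul_left]

theorem hasTrace_comp_rankOne {H : Type} [NormedAddCommGroup H] [InnerProductSpace ℂ H]
    [CompleteSpace H] (T : H →L[ℂ] H) (φ ψ : H) :
    HasTrace (T ∘L (innerSL ℂ ψ).smulRight φ) ⟪ψ, T φ⟫_ℂ := fun J b => by
  have h := b.hasSum_inner_mul_inner ψ (T φ)
  simpa only [ContinuousLinearMap.comp_apply, ContinuousLinearMap.smulRight_apply,
    innerSL_apply_apply, map_smul, inner_smul_right] using h

/-- Testing against `|φ⟩⟨ψ|` returns the matrix element `⟪ψ, X φ⟫`, which the trace on the whole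
system prescribes. -/
theorem IsPartialTrace.unique {ρ : L2 (α ⊕ β) →L[ℂ] L2 (α ⊕ β)} {X Y : L2 α →L[ℂ] L2 α}
    (hX : IsPartialTrace ρ X) (hY : IsPartialTrace ρ Y) : X = Y := by
  refine ContinuousLinearMap.ext fun φ => ext_inner_left ℂ fun ψ => ?_
  obtain ⟨t, h1, h2⟩ := hX.2 _ _ (isTensorId_rankOne φ ψ)
  obtain ⟨t', h1', h2'⟩ := hY.2 _ _ (isTensorId_rankOne φ ψ)
  rw [← h2.unique (hasTrace_comp_rankOne X φ ψ), ← h2'.unique (hasTrace_comp_rankOne Y φ ψ),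
    h1.unique h1']

/-- The map `φ ↦ (S (φ ⊗ c k))_k` into the `ℓ²` direct sum. -/
theorem exists_purification {S : L2 (α ⊕ β) →L[ℂ] L2 (α ⊕ β)} (hHS : IsHilbertSchmidt S)
    {K : Type} (c : HilbertBasis K ℂ (L2 β)) :
    ∃ M : L2 α →L[ℂ] lp (fun _ : K => L2 (α ⊕ β)) 2, ∀ φ k, M φ k = S (tensor φ (c k)) := by
  have hmem : ∀ φ : L2 α, Memℓp (fun k => S (tensor φ (c k))) 2 := fun φ => by
    refine memℓp_gen ?_
    simpa using hHS.comp_right (tensorLeft φ) K c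
  let M : L2 α →ₗ[ℂ] lp (fun _ : K => L2 (α ⊕ β)) 2 :=
    { toFun := fun φ => ⟨fun k => S (tensor φ (c k)), hmem φ⟩
      map_add' := fun φ ψ => lp.ext (funext fun k => by
        change S (tensor (φ + ψ) (c k)) = S (tensor φ (c k)) + S (tensor ψ (c k))
        rw [tensor_add_left, map_add])
      map_smul' := fun a φ => lp.ext (funext fun k => by
        change S (tensor (a • φ) (c k)) = a • S (tensor φ (c k))
        rw [tensor_smul_left, map_smul]) }
  -- Closed graph theorem: each coordinate of `M φ` depends continuously on `φ`, and the coordinates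
  -- determine the limit.
  have hM : Continuous M := by
    refine LinearMap.continuous_of_seq_closed_graph M fun u x y hu hy => ?_
    refine lp.ext (funext fun k => ?_)
    have h1 : Filter.Tendsto (fun n => (M (u n) : K → L2 (α ⊕ β)) k) Filter.atTop
        (nhds ((y : K → L2 (α ⊕ β)) k)) :=
      (((continuous_apply k).comp lp.uniformContinuous_coe.continuous).tendsto y).comp hy
    have h2 : Filter.Tendsto (fun n => S (tensorRight (c k) (u n))) Filter.atTop
        (nhds (S (tensorRight (c k) x))) :=
      ((S.continuous.comp (tensorRight (c k)).continuous).tendsto x).comp hu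
    exact tendsto_nhds_unique h1 h2
  exact ⟨⟨M, hM⟩, fun _ _ => rfl⟩

/-- The reduced operator is `M† M`. The trace of `S S R` in a product basis `b j ⊗ c k`, summed
first over `k`, leaves `⟪M (b j), M (Q (b j))⟫`; the case `Q = 1` gives trace one. -/
theorem exists_isPartialTrace {ρ : L2 (α ⊕ β) →L[ℂ] L2 (α ⊕ β)} (hρ : IsDensityOperator ρ) :
    ∃ X : L2 α →L[ℂ] L2 α, IsPartialTrace ρ X ∧ IsDensityOperator X := by
  obtain ⟨S, hS, hHS, rfl⟩ := exists_hilbertSchmidt_sqrt hρ.positive hρ.traceClass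
  obtain ⟨w, c, -⟩ := exists_hilbertBasis ℂ (L2 β)
  obtain ⟨M, hM⟩ := exists_purification hHS c
  have htr : ∀ (Q : L2 α →L[ℂ] L2 α) (R : L2 (α ⊕ β) →L[ℂ] L2 (α ⊕ β)), IsTensorId Q R →
      ∀ t, HasTrace ((S ∘L S) ∘L R) t → HasTrace ((M† ∘L M) ∘L Q) t := by
    intro Q R hQR t ht J b
    obtain ⟨e, he⟩ := exists_tensorBasis b c
    refine (ht _ e).prod_fiberwise fun j => ?_
    have h1 : ⟪b j, ((M† ∘L M) ∘L Q) (b j)⟫_ℂ = ⟪M (b j), M (Q (b j))⟫_ℂ := by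
      simp only [ContinuousLinearMap.comp_apply, ContinuousLinearMap.adjoint_inner_right]
    rw [h1]
    have h2 := lp.hasSum_inner (𝕜 := ℂ) (M (b j)) (M (Q (b j)))
    simp only [hM] at h2
    refine Eq.subst (motive := fun f => HasSum f _) (funext fun k => ?_) h2
    rw [he, ContinuousLinearMap.comp_apply, hQR, ContinuousLinearMap.comp_apply,
      inner_apply_left_eq_right hS]
  have hpos : (M† ∘L M).IsPositive := ContinuousLinearMap.isPositive_adjoint_comp_self M
  have h1 : HasTrace (M† ∘L M) 1 := htr 1 1 (fun _ _ => rfl) 1 hρ.trace_one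
  refine ⟨M† ∘L M, ⟨isTraceClass_of_isPositive hpos h1, fun Q R hQR => ?_⟩,
    ⟨hpos, isTraceClass_of_isPositive hpos h1, h1⟩⟩
  obtain ⟨t, ht, -⟩ := exists_hasTrace_sandwich hS hHS R
  exact ⟨t, ht, htr Q R hQR t ht⟩

end ReducedState

/-! ### Reflections on composite systems and the coherent resolution of the identity -/

section Marginal

set_option linter.unusedSectionVars false

open scoped InnerProduct

variable {α β : Type} [Fintype α] [Fintype β]

/-- The Grossmann–Royer operator of a subsystem extends to the whole system. -/
theorem exists_isTensorId_royer (ħ : ℝ) (z : α ⊕ α → ℝ) :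
    ∃ R : L2 (α ⊕ β) →L[ℂ] L2 (α ⊕ β), IsTensorId (royer ħ z) R := by
  set x : α → ℝ := fun i => z (Sum.inl i) with hx
  let e := MeasurableEquiv.sumPiEquivProdPi fun _ : α ⊕ β => ℝ
  have hτ : MeasurePreserving (fun y : α ⊕ β → ℝ =>
      e.symm ((2 : ℝ) • x - fun i => y (Sum.inl i), fun i => y (Sum.inr i))) volume volume := by
    have h1 := (measurePreserving_reflection x).prod
      (MeasurePreserving.id (volume : Measure (β → ℝ)))
    exact ((measurePreserving_sumPi (α := α) (β := β)).symm).comp (h1.comp measurePreserving_sumPi)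
  have hθ : Measurable fun y : α ⊕ β → ℝ => royerPhase ħ z fun i => y (Sum.inl i) :=
    (measurable_royerPhase ħ z).comp (by fun_prop)
  obtain ⟨R, -, hR⟩ := exists_phaseComp hτ hθ fun y => norm_royerPhase ħ z _
  refine ⟨R, fun φ ψ => Lp.ext ?_⟩
  filter_upwards [hR (tensor φ ψ), tensor_coeFn (royer ħ z φ) ψ,
    hτ.quasiMeasurePreserving.ae (tensor_coeFn φ ψ),
    quasiMeasurePreserving_inl.ae (royer_coeFn ħ z φ)] with y h1 h2 h3 h4
  rw [h1, h2, h3, h4, mul_assoc]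
  rfl

/-- The phase space point of the whole system made of points of the two subsystems. -/
def joinPhase (z : α ⊕ α → ℝ) (w : β ⊕ β → ℝ) : (α ⊕ β) ⊕ (α ⊕ β) → ℝ :=
  Sum.elim z w ∘ Equiv.sumSumSumComm α β α β

theorem continuous_joinPhase (z : α ⊕ α → ℝ) :
    Continuous (joinPhase z : (β ⊕ β → ℝ) → (α ⊕ β) ⊕ (α ⊕ β) → ℝ) := by
  refine continuous_pi ?_
  rintro ((i | j) | (i | j))
  exacts [continuous_const, continuous_apply _, continuous_const, continuous_apply _]

/-- The exponent is a sum over degrees of freedom, so reflection at a joint point acts as the tensor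
product of the two reflections. -/
theorem inner_royer_joinPhase (ħ : ℝ) (z : α ⊕ α → ℝ) (w : β ⊕ β → ℝ) (v u : α → ℂ)
    (v' u' : β → ℂ) :
    ⟪tensor (coherent v) (coherent v'),
      royer ħ (joinPhase z w) (tensor (coherent u) (coherent u'))⟫_ℂ =
    ⟪coherent v, royer ħ z (coherent u)⟫_ℂ * ⟪coherent v', royer ħ w (coherent u')⟫_ℂ := by
  simp only [tensor_coherent, inner_royer_coherent]
  rw [mul_mul_mul_comm, ← Complex.exp_add, ← Complex.ofReal_mul, ← pow_add, Fintype.card_sum,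
    Fintype.sum_sum_type]
  rfl

/-- The coherent state centered at the phase space point `w`, normalized. -/
noncomputable def unitCoherent (w : β ⊕ β → ℝ) : L2 β :=
  ((‖coherent fun j => (w (Sum.inl j) : ℂ) + Complex.I * w (Sum.inr j)‖⁻¹ : ℝ) : ℂ) •
    coherent fun j => (w (Sum.inl j) : ℂ) + Complex.I * w (Sum.inr j)

theorem norm_coherent_sq (w : β ⊕ β → ℝ) :
    ‖coherent fun j => (w (Sum.inl j) : ℂ) + Complex.I * w (Sum.inr j)‖ ^ 2 =
      Real.sqrt Real.pi ^ Fintype.card β * Real.exp (∑ j, w (Sum.inl j) ^ 2) := by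
  have h := inner_coherent (fun j => (w (Sum.inl j) : ℂ) + Complex.I * w (Sum.inr j))
    (fun j => (w (Sum.inl j) : ℂ) + Complex.I * w (Sum.inr j))
  have h2 : ∀ j, (conj ((w (Sum.inl j) : ℂ) + Complex.I * w (Sum.inr j)) +
      ((w (Sum.inl j) : ℂ) + Complex.I * w (Sum.inr j))) ^ 2 / 4 =
      ((w (Sum.inl j) ^ 2 : ℝ) : ℂ) := fun j => by
    simp only [map_add, map_mul, Complex.conj_ofReal, Complex.conj_I]
    push_cast; ring
  simp only [h2, ← Complex.ofReal_sum, ← Complex.ofReal_exp, ← Complex.ofReal_mul] at h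
  rw [inner_self_eq_norm_sq_to_K] at h
  exact Complex.ofReal_injective (by rw [← h]; push_cast; rfl)

theorem norm_coherent_pos (w : β ⊕ β → ℝ) :
    0 < ‖coherent fun j => (w (Sum.inl j) : ℂ) + Complex.I * w (Sum.inr j)‖ := by
  have h := norm_coherent_sq w
  have h2 : 0 < Real.sqrt Real.pi ^ Fintype.card β * Real.exp (∑ j, w (Sum.inl j) ^ 2) := by
    have := Real.pi_pos
    positivity
  rw [← h] at h2
  exact lt_of_le_of_ne (norm_nonneg _) fun h0 => by simp [← h0] at h2

theorem norm_unitCoherent (w : β ⊕ β → ℝ) : ‖unitCoherent w‖ = 1 := by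
  rw [unitCoherent, norm_smul, Complex.norm_real, norm_inv, norm_norm,
    inv_mul_cancel₀ (norm_coherent_pos w).ne']

theorem continuous_unitCoherent : Continuous (unitCoherent : (β ⊕ β → ℝ) → L2 β) := by
  have h : Continuous fun w : β ⊕ β → ℝ =>
      coherent fun j => (w (Sum.inl j) : ℂ) + Complex.I * w (Sum.inr j) :=
    continuous_coherent.comp (by fun_prop)
  exact (Complex.continuous_ofReal.comp (h.norm.inv₀ fun w => (norm_coherent_pos w).ne')).smul h

/-- The resolution of the identity by coherent states, on coherent states. -/
theorem integral_inner_unitCoherent (v u : β → ℂ) :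
    Integrable (fun w : β ⊕ β → ℝ => ⟪coherent v, unitCoherent w⟫_ℂ * ⟪unitCoherent w, coherent u⟫_ℂ) ∧
    ∫ w : β ⊕ β → ℝ, ⟪coherent v, unitCoherent w⟫_ℂ * ⟪unitCoherent w, coherent u⟫_ℂ =
      (((2 * Real.pi) ^ Fintype.card β : ℝ) : ℂ) * ⟪coherent v, coherent u⟫_ℂ := by
  have hβ : ∀ j : β ⊕ β, (0 : ℝ) < (fun _ => 1 / 2) j := fun _ => by norm_num
  have hi := integrable_cexp_quadratic_pi hβ
    (Sum.elim (fun j => (conj (v j) + u j) / 2) fun j => Complex.I * (conj (v j) - u j) / 2)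
  have h := integral_cexp_quadratic_pi hβ
    (Sum.elim (fun j => (conj (v j) + u j) / 2) fun j => Complex.I * (conj (v j) - u j) / 2)
  set C : ℂ := ((Real.sqrt Real.pi ^ Fintype.card β : ℝ) : ℂ) with hC
  have hC0 : C ≠ 0 := by
    have := Real.pi_pos
    rw [hC, Complex.ofReal_ne_zero]
    positivity
  have e : ∀ w : β ⊕ β → ℝ, ⟪coherent v, unitCoherent w⟫_ℂ * ⟪unitCoherent w, coherent u⟫_ℂ =
      (C * Complex.exp (∑ j, (conj (v j) ^ 2 + u j ^ 2) / 4)) * Complex.exp (∑ j,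
      (-(((1 / 2 : ℝ)) : ℂ) * (w j : ℂ) ^ 2 + Sum.elim (fun j => (conj (v j) + u j) / 2)
        (fun j => Complex.I * (conj (v j) - u j) / 2) j * w j)) := by
    intro w
    have hn : ((‖coherent fun j => (w (Sum.inl j) : ℂ) + Complex.I * w (Sum.inr j)‖⁻¹ : ℝ) : ℂ) ^ 2
        = C⁻¹ * Complex.exp (-∑ j, (w (Sum.inl j) : ℂ) ^ 2) := by
      rw [← Complex.ofReal_pow, inv_pow, norm_coherent_sq, Complex.exp_neg, ← mul_inv, hC]
      push_cast
      rfl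
    rw [unitCoherent, inner_smul_right, inner_smul_left, Complex.conj_ofReal, inner_coherent,
      inner_coherent, ← hC]
    have key : Complex.exp (-∑ j, (w (Sum.inl j) : ℂ) ^ 2) *
        (Complex.exp (∑ i, (conj (v i) + (w (Sum.inl i) + Complex.I * w (Sum.inr i))) ^ 2 / 4) *
        Complex.exp (∑ i, (conj (w (Sum.inl i) + Complex.I * w (Sum.inr i)) + u i) ^ 2 / 4)) =
        Complex.exp (∑ j, (conj (v j) ^ 2 + u j ^ 2) / 4) * Complex.exp (∑ j,
      (-(((1 / 2 : ℝ)) : ℂ) * (w j : ℂ) ^ 2 + Sum.elim (fun j => (conj (v j) + u j) / 2)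
        (fun j => Complex.I * (conj (v j) - u j) / 2) j * w j)) := by
      rw [← Complex.exp_add, ← Complex.exp_add, ← Complex.exp_add, Fintype.sum_sum_type]
      simp only [Sum.elim_inl, Sum.elim_inr, ← Finset.sum_add_distrib, ← Finset.sum_neg_distrib]
      congr 1
      refine Finset.sum_congr rfl fun j _ => ?_
      simp only [map_add, map_mul, Complex.conj_ofReal, Complex.conj_I]
      push_cast
      linear_combination ((w (Sum.inr j) : ℂ) ^ 2 / 2) * Complex.I_sq
    calc _ = (((‖coherent fun j => (w (Sum.inl j) : ℂ) + Complex.I * w (Sum.inr j)‖⁻¹ : ℝ) : ℂ) ^ 2)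
          * (C * C) *
        (Complex.exp (∑ i, (conj (v i) + (w (Sum.inl i) + Complex.I * w (Sum.inr i))) ^ 2 / 4) *
        Complex.exp (∑ i, (conj (w (Sum.inl i) + Complex.I * w (Sum.inr i)) + u i) ^ 2 / 4)) := by
          ring
      _ = C * (Complex.exp (-∑ j, (w (Sum.inl j) : ℂ) ^ 2) *
        (Complex.exp (∑ i, (conj (v i) + (w (Sum.inl i) + Complex.I * w (Sum.inr i))) ^ 2 / 4) *
        Complex.exp (∑ i, (conj (w (Sum.inl i) + Complex.I * w (Sum.inr i)) + u i) ^ 2 / 4))) := by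
          rw [hn]; field_simp
      _ = _ := by rw [key, mul_assoc]
  -- Each of the `2n` phase space coordinates contributes `√(2π)`.
  have hconst : ((∏ j : β ⊕ β, Real.sqrt (Real.pi / (fun _ => 1 / 2) j) : ℝ) : ℂ) =
      (((2 * Real.pi) ^ Fintype.card β : ℝ) : ℂ) := by
    rw [Fintype.prod_sum_type]
    simp only [Finset.prod_const, Finset.card_univ, ← mul_pow]
    congr 2
    rw [Real.mul_self_sqrt (by positivity)]
    ring
  simp only [e]
  refine ⟨hi.const_mul _, ?_⟩
  rw [integral_const_mul, h, hconst, inner_coherent, ← hC]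
  have key : Complex.exp (∑ j, (conj (v j) ^ 2 + u j ^ 2) / 4) * Complex.exp (∑ j,
      Sum.elim (fun j => (conj (v j) + u j) / 2)
        (fun j => Complex.I * (conj (v j) - u j) / 2) j ^ 2 / (4 * (((1 / 2 : ℝ)) : ℂ))) =
      Complex.exp (∑ i, (conj (v i) + u i) ^ 2 / 4) := by
    rw [← Complex.exp_add, Fintype.sum_sum_type]
    simp only [Sum.elim_inl, Sum.elim_inr, ← Finset.sum_add_distrib]
    congr 1
    refine Finset.sum_congr rfl fun j _ => ?_
    push_cast
    linear_combination ((conj (v j) - u j) ^ 2 / 8) * Complex.I_sq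
  linear_combination (C * (((2 * Real.pi) ^ Fintype.card β : ℝ) : ℂ)) * key

/-- The diagonal matrix elements of the Grossmann–Royer operators in coherent states. -/
theorem inner_unitCoherent_royer (ħ : ℝ) (w w' : β ⊕ β → ℝ) :
    ⟪unitCoherent w, royer ħ w' (unitCoherent w)⟫_ℂ = ((Real.exp (-∑ j,
      (w j - Sum.elim (fun i => w' (Sum.inl i)) (fun i => w' (Sum.inr i) / ħ) j) ^ 2) : ℝ) : ℂ) := by
  set C : ℂ := ((Real.sqrt Real.pi ^ Fintype.card β : ℝ) : ℂ) with hC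
  have hC0 : C ≠ 0 := by
    have := Real.pi_pos
    rw [hC, Complex.ofReal_ne_zero]
    positivity
  have hn : ((‖coherent fun j => (w (Sum.inl j) : ℂ) + Complex.I * w (Sum.inr j)‖⁻¹ : ℝ) : ℂ) ^ 2
      = C⁻¹ * Complex.exp (-∑ j, (w (Sum.inl j) : ℂ) ^ 2) := by
    rw [← Complex.ofReal_pow, inv_pow, norm_coherent_sq, Complex.exp_neg, ← mul_inv, hC]
    push_cast
    rfl
  rw [unitCoherent, map_smul, inner_smul_right, inner_smul_left, Complex.conj_ofReal,
    inner_royer_coherent, ← hC, ← mul_assoc, ← mul_assoc, ← sq, hn, mul_right_comm C⁻¹,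
    inv_mul_cancel₀ hC0, one_mul, ← Complex.exp_add, Complex.ofReal_exp]
  congr 1
  push_cast
  rw [Fintype.sum_sum_type, neg_add, ← Finset.sum_neg_distrib, ← Finset.sum_neg_distrib,
    ← Finset.sum_neg_distrib, ← Finset.sum_add_distrib, ← Finset.sum_add_distrib]
  refine Finset.sum_congr rfl fun j _ => ?_
  simp only [map_add, map_mul, Complex.conj_ofReal, Complex.conj_I, Sum.elim_inl, Sum.elim_inr]
  push_cast
  linear_combination ((w (Sum.inr j) : ℂ) ^ 2 - 2 * w (Sum.inr j) * (w' (Sum.inr j) / ħ)) * Complex.I_sq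

end Marginal

/-! ### The Wigner function of the reduced state as a marginal -/

section MarginalTrace

open scoped InnerProduct

variable {α β : Type} [Fintype α] [Fintype β]

theorem norm_tensorRight_le (ψ : L2 β) : ‖tensorRight (α := α) ψ‖ ≤ ‖ψ‖ :=
  ContinuousLinearMap.opNorm_le_bound _ (norm_nonneg _) fun φ => by
    rw [tensorRight_apply, norm_tensor, mul_comm]

/-- Partial inner product with the coherent state at `w`. -/
noncomputable def coherentSlice (w : β ⊕ β → ℝ) : L2 (α ⊕ β) →L[ℂ] L2 α :=
  (tensorRight (unitCoherent w))†

theorem norm_coherentSlice_le (w : β ⊕ β → ℝ) : ‖coherentSlice (α := α) w‖ ≤ 1 := by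
  rw [coherentSlice, LinearIsometryEquiv.norm_map, ← norm_unitCoherent w]
  exact norm_tensorRight_le _

theorem coherentSlice_tensor (w : β ⊕ β → ℝ) (φ : L2 α) (ψ : L2 β) :
    coherentSlice w (tensor φ ψ) = ⟪unitCoherent w, ψ⟫_ℂ • φ :=
  adjoint_tensorRight_tensor _ _ _

theorem continuous_coherentSlice_apply (a : L2 (α ⊕ β)) :
    Continuous fun w => coherentSlice (α := α) (β := β) w a := by
  refine continuous_apply_of_dense_span dense_span_tensor_coherent norm_coherentSlice_le ?_ a
  rintro _ ⟨p, rfl⟩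
  simp only [coherentSlice_tensor]
  have h : Continuous fun w : β ⊕ β → ℝ => ⟪unitCoherent w, coherent p.2⟫_ℂ :=
    continuous_unitCoherent.inner continuous_const
  exact h.smul continuous_const

/-- The resolution of the identity on the second factor, tensored with the identity on the first: on
product tensors the first factor is carried along as a constant. -/
theorem integral_inner_coherentSlice (a a' : L2 (α ⊕ β)) :
    Integrable (fun w => ⟪coherentSlice (α := α) (β := β) w a, coherentSlice w a'⟫_ℂ) ∧
    ∫ w, ⟪coherentSlice (α := α) (β := β) w a, coherentSlice w a'⟫_ℂ =
      (((2 * Real.pi) ^ Fintype.card β : ℝ) : ℂ) * ⟪a, a'⟫_ℂ := by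
  refine integral_inner_frame dense_span_tensor_coherent continuous_coherentSlice_apply
    (by have := Real.pi_pos; positivity) ?_ a a'
  rintro _ ⟨p, rfl⟩ _ ⟨q, rfl⟩
  obtain ⟨h1, h2⟩ := integral_inner_unitCoherent p.2 q.2
  have e : ∀ w, ⟪coherentSlice w (tensor (coherent p.1) (coherent p.2)),
      coherentSlice w (tensor (coherent q.1) (coherent q.2))⟫_ℂ =
      (⟪coherent p.2, unitCoherent w⟫_ℂ * ⟪unitCoherent w, coherent q.2⟫_ℂ) *
        ⟪coherent p.1, coherent q.1⟫_ℂ := fun w => by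
    rw [coherentSlice_tensor, coherentSlice_tensor, inner_smul_left, inner_smul_right,
      inner_conj_symm, mul_assoc]
  simp only [e, inner_tensor]
  exact ⟨h1.mul_const _, by rw [integral_mul_const, h2]; ring⟩

/-- Slicing touches only the second factor and `Q ⊗ I` only the first, so they commute. -/
theorem coherentSlice_comp {Q : L2 α →L[ℂ] L2 α} {R : L2 (α ⊕ β) →L[ℂ] L2 (α ⊕ β)}
    (hQR : IsTensorId Q R) (w : β ⊕ β → ℝ) (a : L2 (α ⊕ β)) :
    coherentSlice w (R a) = Q (coherentSlice w a) := by
  have : coherentSlice w ∘L R = Q ∘L coherentSlice w := by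
    refine ContinuousLinearMap.ext_on dense_span_tensor_coherent ?_
    rintro _ ⟨p, rfl⟩
    simp only [ContinuousLinearMap.comp_apply]
    rw [hQR, coherentSlice_tensor, coherentSlice_tensor, map_smul]
  exact congrArg (fun A : L2 (α ⊕ β) →L[ℂ] L2 α => A a) this

theorem integrable_exp_neg_sum_sq (κ : Type) [Fintype κ] (c : κ → ℝ) :
    Integrable (fun v : κ → ℝ => Real.exp (-∑ j, (v j - c j) ^ 2)) ∧
    ∫ v : κ → ℝ, Real.exp (-∑ j, (v j - c j) ^ 2) = Real.sqrt Real.pi ^ Fintype.card κ := by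
  have hi := integrable_cexp_quadratic_pi (β := fun _ : κ => 1) (fun _ => one_pos) 0
  have h := integral_cexp_quadratic_pi (β := fun _ : κ => 1) (fun _ => one_pos) 0
  have e : ∀ v : κ → ℝ, Complex.exp (∑ j, (-(((1 : ℝ)) : ℂ) * (v j : ℂ) ^ 2 + (0 : κ → ℂ) j * v j)) =
      ((Real.exp (-∑ j, (v j) ^ 2) : ℝ) : ℂ) := fun v => by
    push_cast
    simp [Finset.sum_neg_distrib]
  simp only [e] at hi h
  rw [integral_complex_ofReal] at h
  have hi' : Integrable fun v : κ → ℝ => Real.exp (-∑ j, (v j) ^ 2) := by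
    have := hi.re
    simpa only [RCLike.re_to_complex, Complex.ofReal_re] using this
  refine ⟨hi'.comp_sub_right c, ?_⟩
  have h5 := integral_sub_right_eq_self (μ := volume)
    (fun v : κ → ℝ => Real.exp (-∑ j, (v j) ^ 2)) c
  simp only [Pi.sub_apply] at h5
  rw [h5]
  simp only [div_one, Finset.prod_const, Finset.card_univ, Pi.zero_apply, ne_eq,
    OfNat.ofNat_ne_zero, not_false_eq_true, zero_pow, zero_div, Finset.sum_const_zero,
    Complex.exp_zero, mul_one] at h
  exact Complex.ofReal_injective h

/-- Fubini: the integral of the Gaussian in `v` does not depend on its center `c w`. -/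
theorem integral_integral_exp_neg_sum_sq {κ Ω : Type} [Fintype κ] [MeasureSpace Ω]
    [SFinite (volume : Measure Ω)] {c : Ω → κ → ℝ} (hc : Measurable c) {F : Ω → ℂ}
    (hF : Integrable F) :
    ∫ v : κ → ℝ, ∫ w, ((Real.exp (-∑ j, (v j - c w j) ^ 2) : ℝ) : ℂ) * F w =
      ((Real.sqrt Real.pi ^ Fintype.card κ : ℝ) : ℂ) * ∫ w, F w := by
  have hm : Measurable fun p : (κ → ℝ) × Ω => ((Real.exp (-∑ j, (p.1 j - c p.2 j) ^ 2) : ℝ) : ℂ) := by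
    have h1 : ∀ j, Measurable fun p : (κ → ℝ) × Ω => c p.2 j := fun j =>
      (measurable_pi_apply j).comp (hc.comp measurable_snd)
    have h2 : ∀ j, Measurable fun p : (κ → ℝ) × Ω => p.1 j := fun j =>
      (measurable_pi_apply j).comp measurable_fst
    exact Complex.measurable_ofReal.comp (Real.measurable_exp.comp
      (Finset.measurable_sum _ fun j _ => ((h2 j).sub (h1 j)).pow_const 2).neg)
  rw [integral_integral_swap]
  · simp only [integral_mul_const, integral_complex_ofReal, (integrable_exp_neg_sum_sq κ _).2]
    rw [integral_const_mul]
  · have hmeas : AEStronglyMeasurable (fun p : (κ → ℝ) × Ω =>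
        ((Real.exp (-∑ j, (p.1 j - c p.2 j) ^ 2) : ℝ) : ℂ) * F p.2) (volume.prod volume) :=
      hm.aestronglyMeasurable.mul hF.1.comp_snd
    change Integrable (fun p : (κ → ℝ) × Ω =>
        ((Real.exp (-∑ j, (p.1 j - c p.2 j) ^ 2) : ℝ) : ℂ) * F p.2) (volume.prod volume)
    rw [integrable_prod_iff' hmeas]
    refine ⟨Filter.Eventually.of_forall fun w =>
      ((integrable_exp_neg_sum_sq κ (c w)).1.ofReal.mul_const (F w)), ?_⟩
    have hn : ∀ w, ∫ v : κ → ℝ, ‖((Real.exp (-∑ j, (v j - c w j) ^ 2) : ℝ) : ℂ) * F w‖ =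
        Real.sqrt Real.pi ^ Fintype.card κ * ‖F w‖ := fun w => by
      simp only [norm_mul, Complex.norm_real, Real.norm_eq_abs, Real.abs_exp]
      rw [integral_mul_const, (integrable_exp_neg_sum_sq κ (c w)).2]
    simp only [hn]
    exact hF.norm.const_mul _

theorem continuous_royer_joinPhase (ħ : ℝ) (z : α ⊕ α → ℝ) (a : L2 (α ⊕ β)) :
    Continuous fun w => royer ħ (joinPhase (β := β) z w) a :=
  (continuous_royer_apply ħ a).comp (continuous_joinPhase z)

theorem integrable_inner_unitCoherent_royer {ħ : ℝ} (hħ : 0 < ħ) (w : β ⊕ β → ℝ) :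
    Integrable fun w' => ⟪unitCoherent w, royer ħ w' (unitCoherent w)⟫_ℂ := by
  simp only [unitCoherent, map_smul, inner_smul_left, inner_smul_right]
  exact ((integrable_inner_royer_coherent hħ _ _).const_mul _).const_mul _

/-- `Q ⊗ |h⟩⟨h|`, for `Q` a Grossmann–Royer operator and `h` a coherent state, as a weak integral of
Grossmann–Royer operators. -/
theorem integral_mul_inner_royer_joinPhase {ħ : ℝ} (hħ : 0 < ħ) (z : α ⊕ α → ℝ) (w : β ⊕ β → ℝ)
    (a a' : L2 (α ⊕ β)) :
    ∫ w', ⟪unitCoherent w, royer ħ w' (unitCoherent w)⟫_ℂ * ⟪a, royer ħ (joinPhase z w') a'⟫_ℂ =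
      (((Real.pi * ħ / 2) ^ Fintype.card β : ℝ) : ℂ) *
        ⟪coherentSlice w a, royer ħ z (coherentSlice w a')⟫_ℂ := by
  have h := integral_inner_eq_of_dense_span dense_span_tensor_coherent
    (fun w' => norm_royer_le ħ (joinPhase z w')) (continuous_royer_joinPhase ħ z)
    (integrable_inner_unitCoherent_royer hħ w)
    ((((Real.pi * ħ / 2) ^ Fintype.card β : ℝ) : ℂ) •
      ((coherentSlice w)† ∘L royer ħ z ∘L coherentSlice w)) ?_ a a'
  · rw [h]
    simp only [smul_apply, ContinuousLinearMap.comp_apply, inner_smul_right,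
      ContinuousLinearMap.adjoint_inner_right]
  · rintro _ ⟨p, rfl⟩ _ ⟨q, rfl⟩
    simp only [smul_apply, ContinuousLinearMap.comp_apply, inner_smul_right,
      ContinuousLinearMap.adjoint_inner_right, coherentSlice_tensor, inner_royer_joinPhase,
      map_smul, inner_smul_left, inner_conj_symm]
    simp only [mul_left_comm _ ⟪coherent p.1, royer ħ z (coherent q.1)⟫_ℂ]
    rw [integral_const_mul]
    simp only [unitCoherent, map_smul, inner_smul_left, inner_smul_right, mul_assoc]
    rw [integral_const_mul, integral_const_mul, integral_inner_royer_coherent_mul hħ]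
    ring

/-- The Wigner transform of a reduced state is the marginal of the Wigner transform. -/
theorem hasTrace_comp_royer_tensorId {ħ : ℝ} (hħ : 0 < ħ) {S : L2 (α ⊕ β) →L[ℂ] L2 (α ⊕ β)}
    (hS : S† = S) (hHS : IsHilbertSchmidt S) (z : α ⊕ α → ℝ)
    {R : L2 (α ⊕ β) →L[ℂ] L2 (α ⊕ β)} (hR : IsTensorId (royer ħ z) R)
    {F : (β ⊕ β → ℝ) → ℂ} (hFi : Integrable F)
    (hF : ∀ w, HasTrace ((S ∘L S) ∘L royer ħ (joinPhase z w)) (F w)) :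
    HasTrace ((S ∘L S) ∘L R)
      ((((1 / (Real.pi * ħ)) ^ Fintype.card β : ℝ) : ℂ) * ∫ w, F w) := by
  obtain ⟨J, b, -⟩ := exists_hilbertBasis ℂ (L2 (α ⊕ β))
  have := b.countable_index
  have hsum : ∀ w, HasSum (fun j => ⟪S (b j), royer ħ (joinPhase z w) (S (b j))⟫_ℂ) (F w) := by
    intro w
    obtain ⟨t, h1, -, h3⟩ := exists_hasTrace_sandwich hS hHS (royer ħ (joinPhase z w))
    rw [(hF w).unique h1]
    exact h3 _ b
  obtain ⟨t, h1, -, h3⟩ := exists_hasTrace_sandwich hS hHS R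
  set c : ℂ := (((Real.pi * ħ / 2) ^ Fintype.card β : ℝ) : ℂ) with hc
  have hpi := Real.pi_pos
  have hc0 : c ≠ 0 := by
    rw [hc, Complex.ofReal_ne_zero]
    positivity
  -- For fixed `w` this is the trace of `S S` against `R(z) ⊗ |h_w⟩⟨h_w|`, with `h_w` the normalized
  -- coherent state, expressed through `F` by averaging reflections.
  have hinner : ∀ w, HasSum (fun j => ⟪coherentSlice w (S (b j)), coherentSlice w (R (S (b j)))⟫_ℂ)
      (c⁻¹ * ∫ w', ⟪unitCoherent w, royer ħ w' (unitCoherent w)⟫_ℂ * F w') := by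
    intro w
    have h := (hasSum_integral_mul_inner_apply (fun w' => norm_royer_le ħ (joinPhase z w'))
      (continuous_royer_joinPhase ħ z) (hHS _ b) hsum
      (integrable_inner_unitCoherent_royer hħ w)).mul_left c⁻¹
    refine Eq.subst (motive := fun f => HasSum f _) (funext fun j => ?_) h
    rw [integral_mul_inner_royer_joinPhase hħ, ← hc, ← mul_assoc, inv_mul_cancel₀ hc0, one_mul,
      coherentSlice_comp hR]
  -- Integrating over `w` restores the identity on the second factor.
  have houter := hasSum_integral_of_summable_integral_norm (μ := volume)
    (F := fun j (w : β ⊕ β → ℝ) =>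
      ⟪coherentSlice w (S (b j)), coherentSlice w (R (S (b j)))⟫_ℂ)
    (fun j => (integral_inner_coherentSlice _ _).1) ?_
  · simp only [(integral_inner_coherentSlice _ _).2, (hinner _).tsum_eq] at houter
    have h4 := ((h3 _ b).mul_left (((2 * Real.pi) ^ Fintype.card β : ℝ) : ℂ)).unique houter
    rw [integral_const_mul] at h4
    -- The kernel is a unit-height Gaussian in `w` centered at a point depending on `w'`; its
    -- integral is `√π` per coordinate.
    have hk : ∫ w, ∫ w', ⟪unitCoherent w, royer ħ w' (unitCoherent w)⟫_ℂ * F w' =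
        ((Real.pi ^ Fintype.card β : ℝ) : ℂ) * ∫ w', F w' := by
      have hsq : Real.sqrt Real.pi ^ Fintype.card (β ⊕ β) = Real.pi ^ Fintype.card β := by
        rw [Fintype.card_sum, pow_add, ← mul_pow, Real.mul_self_sqrt hpi.le]
      simp only [inner_unitCoherent_royer]
      rw [← hsq]
      refine integral_integral_exp_neg_sum_sq (measurable_pi_lambda _ ?_) hFi
      rintro (j | j) <;> simp only [Sum.elim_inl, Sum.elim_inr] <;> fun_prop
    rw [hk] at h4
    have ht : t = (((1 / (Real.pi * ħ)) ^ Fintype.card β : ℝ) : ℂ) * ∫ w, F w := by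
      have h2pi : (((2 * Real.pi) ^ Fintype.card β : ℝ) : ℂ) ≠ 0 := by
        rw [Complex.ofReal_ne_zero]; positivity
      refine mul_left_cancel₀ h2pi (h4.trans ?_)
      rw [← mul_assoc, ← mul_assoc, hc]
      congr 1
      rw [← Complex.ofReal_inv, ← Complex.ofReal_mul, ← Complex.ofReal_mul, ← inv_pow, ← mul_pow,
        ← mul_pow]
      congr 2
      field_simp
    rw [← ht]
    exact h1
  -- After slicing, `R` acts as the contraction `royer ħ z`, so the `j`-th integral is at most
  -- `(2π)^n ‖S (b j)‖²`.
  · refine Summable.of_nonneg_of_le (fun j => integral_nonneg fun _ => norm_nonneg _) (fun j => ?_)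
      ((hHS _ b).mul_left ((2 * Real.pi) ^ Fintype.card β))
    have hI := integral_inner_coherentSlice (α := α) (β := β) (S (b j)) (S (b j))
    have hr : ∀ w : β ⊕ β → ℝ, ⟪coherentSlice w (S (b j)), coherentSlice w (S (b j))⟫_ℂ =
        ((‖coherentSlice (α := α) w (S (b j))‖ ^ 2 : ℝ) : ℂ) := fun w => by
      rw [inner_self_eq_norm_sq_to_K]; push_cast; rfl
    have hr' : (((2 * Real.pi) ^ Fintype.card β : ℝ) : ℂ) * ⟪S (b j), S (b j)⟫_ℂ =
        (((2 * Real.pi) ^ Fintype.card β * ‖S (b j)‖ ^ 2 : ℝ) : ℂ) := by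
      rw [inner_self_eq_norm_sq_to_K]; push_cast; rfl
    simp only [hr] at hI
    rw [hr', integral_complex_ofReal, Complex.ofReal_inj] at hI
    rw [← hI.2]
    refine integral_mono (integral_inner_coherentSlice _ _).1.norm 
      (by simpa only [RCLike.re_to_complex, Complex.ofReal_re] using hI.1.re) fun w => ?_
    dsimp only
    rw [coherentSlice_comp hR, sq]
    exact norm_inner_apply_le (norm_royer_le ħ z) _ _

end MarginalTrace

/-! ### Positive square roots of real matrices -/

section MatrixRoots

open scoped MatrixOrder

variable {κ : Type} [Fintype κ] [DecidableEq κ]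

theorem Matrix.PosDef.exists_sqrt {M : Matrix κ κ ℝ} (hM : M.PosDef) :
    ∃ P : Matrix κ κ ℝ, P.PosDef ∧ P.transpose = P ∧ P * P = M := by
  have h0 : 0 ≤ M := Matrix.nonneg_iff_posSemidef.2 hM.posSemidef
  have h1 : CFC.sqrt M * CFC.sqrt M = M := CFC.sqrt_mul_sqrt_self M h0
  have h2 : (CFC.sqrt M).PosSemidef := Matrix.nonneg_iff_posSemidef.1 (CFC.sqrt_nonneg M)
  refine ⟨CFC.sqrt M, h2.posDef_iff_det_ne_zero.2 fun h => ?_, ?_, h1⟩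
  · have := hM.det_pos
    rw [← h1, Matrix.det_mul, h, zero_mul] at this
    exact lt_irrefl _ this
  · have := h2.1
    rwa [Matrix.IsHermitian, Matrix.conjTranspose_eq_transpose_of_trivial] at this

/-- Uniqueness of the positive square root. The symplectic argument uses it to identify two positive
matrices by comparing their squares. -/
theorem Matrix.PosSemidef.eq_of_mul_self_eq {P Q : Matrix κ κ ℝ} (hP : P.PosSemidef)
    (hQ : Q.PosSemidef) (h : P * P = Q * Q) : P = Q := by
  rw [← CFC.sqrt_mul_self P (Matrix.nonneg_iff_posSemidef.2 hP), h,
    CFC.sqrt_mul_self Q (Matrix.nonneg_iff_posSemidef.2 hQ)]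

end MatrixRoots

/-! ### Gaussian integrals with matrix covariance and their marginals -/

section GaussianMatrix

variable {κ : Type} [Fintype κ] [DecidableEq κ]

theorem integrable_exp_neg_half_sum_sq (κ : Type) [Fintype κ] :
    Integrable (fun v : κ → ℝ => Real.exp (-(1 / 2) * ∑ j, v j ^ 2)) ∧
    ∫ v : κ → ℝ, Real.exp (-(1 / 2) * ∑ j, v j ^ 2) = Real.sqrt (2 * Real.pi) ^ Fintype.card κ := by
  have hi := integrable_cexp_quadratic_pi (β := fun _ : κ => 1 / 2) (fun _ => by norm_num) 0
  have h := integral_cexp_quadratic_pi (β := fun _ : κ => 1 / 2) (fun _ => by norm_num) 0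
  have e : ∀ v : κ → ℝ,
      Complex.exp (∑ j, (-(((1 / 2 : ℝ)) : ℂ) * (v j : ℂ) ^ 2 + (0 : κ → ℂ) j * v j)) =
      ((Real.exp (-(1 / 2) * ∑ j, (v j) ^ 2) : ℝ) : ℂ) := fun v => by
    push_cast
    simp [Finset.mul_sum]
  simp only [e] at hi h
  rw [integral_complex_ofReal] at h
  have hi' := hi.re
  simp only [RCLike.re_to_complex, Complex.ofReal_re] at hi'
  refine ⟨hi', ?_⟩
  simp only [div_div_eq_mul_div, div_one, Finset.prod_const, Finset.card_univ, Pi.zero_apply, ne_eq,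
    OfNat.ofNat_ne_zero, not_false_eq_true, zero_pow, zero_div, Finset.sum_const_zero,
    Complex.exp_zero, mul_one, mul_comm Real.pi] at h
  exact Complex.ofReal_injective h

/-- The Gaussian integral of a positive definite quadratic form. -/
theorem integral_exp_quadraticForm {M : Matrix κ κ ℝ} (hM : M.PosDef) :
    Integrable (fun v : κ → ℝ => Real.exp (-(1 / 2) * (v ⬝ᵥ M.mulVec v))) ∧
    ∫ v : κ → ℝ, Real.exp (-(1 / 2) * (v ⬝ᵥ M.mulVec v)) =
      Real.sqrt (2 * Real.pi) ^ Fintype.card κ / Real.sqrt M.det := by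
  obtain ⟨P, hP, hPT, hPM⟩ := hM.exists_sqrt
  have hdet : P.det ≠ 0 := hP.det_pos.ne'
  obtain ⟨hi, hg⟩ := integrable_exp_neg_half_sum_sq κ
  -- With `P² = M`, the change of variables `v ↦ P v` reduces to the standard Gaussian with Jacobian
  -- factor `(det P)⁻¹ = (det M)^(-1/2)`.
  have hmap := Real.map_matrix_volume_pi_eq_smul_volume_pi hdet
  have e : ∀ v : κ → ℝ, Real.exp (-(1 / 2) * (v ⬝ᵥ M.mulVec v)) =
      Real.exp (-(1 / 2) * ∑ j, (Matrix.toLin' P v) j ^ 2) := fun v => by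
    have : v ⬝ᵥ M.mulVec v = ∑ j, (P.mulVec v) j ^ 2 := by
      rw [← hPM, ← Matrix.mulVec_mulVec, Matrix.dotProduct_mulVec, ← Matrix.mulVec_transpose, hPT]
      simp only [dotProduct, sq]
    rw [this, Matrix.toLin'_apply]
  have hc : Continuous (Matrix.toLin' P) := LinearMap.continuous_of_finiteDimensional _
  have hgm : ∀ μ : Measure (κ → ℝ), AEStronglyMeasurable
      (fun v : κ → ℝ => Real.exp (-(1 / 2) * ∑ j, v j ^ 2)) μ := fun μ =>
    Continuous.aestronglyMeasurable (by fun_prop)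
  simp only [e]
  constructor
  · have h1 : Integrable (fun v : κ → ℝ => Real.exp (-(1 / 2) * ∑ j, v j ^ 2))
        (Measure.map (Matrix.toLin' P) volume) := by
      rw [hmap]
      exact hi.smul_measure ENNReal.ofReal_ne_top
    exact (integrable_map_measure (hgm _) hc.aemeasurable).1 h1
  · have h1 := integral_map (μ := volume) hc.aemeasurable (hgm _)
    rw [hmap, integral_smul_measure, hg, ENNReal.toReal_ofReal (abs_nonneg _)] at h1
    rw [← h1, ← hPM, Matrix.det_mul, Real.sqrt_mul_self hP.det_pos.le, abs_inv,
      abs_of_pos hP.det_pos, smul_eq_mul, mul_comm, div_eq_mul_inv]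

variable {κ' : Type} [Fintype κ'] [DecidableEq κ']

/-- Completing the square with the Schur complement `E` of `A`. Instead of inverting the block
matrix, the linear system `S (u, v) = (x, y)` is solved by elimination, giving `y - Bᵀ A⁻¹ x = E v`.
-/
theorem quadraticForm_inv_fromBlocks {A : Matrix κ κ ℝ} {B : Matrix κ κ' ℝ} {D : Matrix κ' κ' ℝ}
    (hA : A.PosDef) (hS : (Matrix.fromBlocks A B B.transpose D).PosDef)
    (hE : (D - B.transpose * A⁻¹ * B).PosDef) (x : κ → ℝ) (y : κ' → ℝ) :
    Sum.elim x y ⬝ᵥ (Matrix.fromBlocks A B B.transpose D)⁻¹.mulVec (Sum.elim x y) =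
      x ⬝ᵥ A⁻¹.mulVec x + (y - (B.transpose * A⁻¹).mulVec x) ⬝ᵥ
        (D - B.transpose * A⁻¹ * B)⁻¹.mulVec (y - (B.transpose * A⁻¹).mulVec x) := by
  set S := Matrix.fromBlocks A B B.transpose D with hSdef
  set E := D - B.transpose * A⁻¹ * B with hEdef
  have hAu : IsUnit A.det := isUnit_iff_ne_zero.2 hA.det_pos.ne'
  have hSu : IsUnit S.det := isUnit_iff_ne_zero.2 hS.det_pos.ne'
  have hEu : IsUnit E.det := isUnit_iff_ne_zero.2 hE.det_pos.ne'
  have hAT : A.transpose = A := by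
    simpa [Matrix.IsHermitian, Matrix.conjTranspose_eq_transpose_of_trivial] using hA.1
  obtain ⟨u, v, huv⟩ : ∃ u v, S⁻¹.mulVec (Sum.elim x y) = Sum.elim u v :=
    ⟨_, _, (Sum.elim_comp_inl_inr _).symm⟩
  have h1 : S.mulVec (Sum.elim u v) = Sum.elim x y := by
    rw [← huv, Matrix.mulVec_mulVec, Matrix.mul_nonsing_inv _ hSu, Matrix.one_mulVec]
  rw [hSdef, Matrix.fromBlocks_mulVec] at h1
  have hx : A.mulVec u + B.mulVec v = x := by
    ext i; simpa using congrFun h1 (Sum.inl i)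
  have hy : B.transpose.mulVec u + D.mulVec v = y := by
    ext i; simpa using congrFun h1 (Sum.inr i)
  have hAx : A⁻¹.mulVec x = u + (A⁻¹ * B).mulVec v := by
    rw [← hx, Matrix.mulVec_add, Matrix.mulVec_mulVec, Matrix.nonsing_inv_mul _ hAu,
      Matrix.one_mulVec, Matrix.mulVec_mulVec]
  have hyx : y - (B.transpose * A⁻¹).mulVec x = E.mulVec v := by
    rw [← Matrix.mulVec_mulVec, hAx, ← hy, hEdef, Matrix.sub_mulVec, Matrix.mulVec_add,
      Matrix.mulVec_mulVec, Matrix.mul_assoc]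
    abel
  rw [huv, hyx, Matrix.mulVec_mulVec, Matrix.nonsing_inv_mul _ hEu, Matrix.one_mulVec, hAx,
    ← hyx, dotProduct_add, sub_dotProduct]
  have h2 : x ⬝ᵥ (A⁻¹ * B).mulVec v = (B.transpose * A⁻¹).mulVec x ⬝ᵥ v := by
    rw [Matrix.dotProduct_mulVec, ← Matrix.mulVec_transpose, Matrix.transpose_mul,
      Matrix.transpose_nonsing_inv, hAT]
  rw [h2]
  have h3 : Sum.elim x y ⬝ᵥ Sum.elim u v = x ⬝ᵥ u + y ⬝ᵥ v := by
    simp [dotProduct, Fintype.sum_sum_type]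
  rw [h3]
  ring

/-- The marginal of a centered Gaussian. -/
theorem integral_exp_fromBlocks {A : Matrix κ κ ℝ} {B : Matrix κ κ' ℝ} {D : Matrix κ' κ' ℝ}
    (hS : (Matrix.fromBlocks A B B.transpose D).PosDef) (x : κ → ℝ) :
    Integrable (fun y : κ' → ℝ => Real.exp (-(1 / 2) * (Sum.elim x y ⬝ᵥ
      (Matrix.fromBlocks A B B.transpose D)⁻¹.mulVec (Sum.elim x y)))) ∧
    ∫ y : κ' → ℝ, Real.exp (-(1 / 2) * (Sum.elim x y ⬝ᵥ
      (Matrix.fromBlocks A B B.transpose D)⁻¹.mulVec (Sum.elim x y))) =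
      Real.sqrt (2 * Real.pi) ^ Fintype.card κ' *
        (Real.sqrt (Matrix.fromBlocks A B B.transpose D).det / Real.sqrt A.det) *
        Real.exp (-(1 / 2) * (x ⬝ᵥ A⁻¹.mulVec x)) := by
  have hA : A.PosDef := by
    have := hS.submatrix (e := (Sum.inl : κ → κ ⊕ κ')) Sum.inl_injective
    rwa [show (Matrix.fromBlocks A B B.transpose D).submatrix Sum.inl Sum.inl = A from by
      ext i j; rfl] at this
  have := hA.isUnit.invertible
  have hdet : (Matrix.fromBlocks A B B.transpose D).det =
      A.det * (D - B.transpose * A⁻¹ * B).det := by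
    rw [Matrix.det_fromBlocks₁₁, Matrix.invOf_eq_nonsing_inv]
  have hE : (D - B.transpose * A⁻¹ * B).PosDef := by
    have h1 := (Matrix.PosDef.fromBlocks₁₁ B D hA).1 (by
      rw [Matrix.conjTranspose_eq_transpose_of_trivial]; exact hS.posSemidef)
    rw [Matrix.conjTranspose_eq_transpose_of_trivial] at h1
    refine h1.posDef_iff_det_ne_zero.2 fun h => ?_
    have h2 := hS.det_pos
    rw [hdet, h, mul_zero] at h2
    exact lt_irrefl _ h2
  obtain ⟨hi, hg⟩ := integral_exp_quadraticForm hE.inv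
  simp only [quadraticForm_inv_fromBlocks hA hS hE, mul_add, Real.exp_add]
  refine ⟨(hi.comp_sub_right ((B.transpose * A⁻¹).mulVec x)).const_mul _, ?_⟩
  rw [integral_const_mul, integral_sub_right_eq_self (fun y : κ' → ℝ =>
    Real.exp (-(1 / 2) * (y ⬝ᵥ (D - B.transpose * A⁻¹ * B)⁻¹.mulVec y))), hg,
    Matrix.det_nonsing_inv, Ring.inverse_eq_inv', Real.sqrt_inv, div_inv_eq_mul, hdet,
    Real.sqrt_mul hA.det_pos.le, mul_div_cancel_left₀ _ (Real.sqrt_pos.2 hA.det_pos).ne']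
  ring

end GaussianMatrix

/-! ### The Gaussian density and its square -/

section GaussianDensity

variable {ι : Type} [Fintype ι] [DecidableEq ι]

theorem gaussianDensity_integrable {S : Matrix (ι ⊕ ι) (ι ⊕ ι) ℝ} (hS : S.PosDef) :
    Integrable (gaussianDensity S) :=
  (integral_exp_quadraticForm hS.inv).1.const_mul _

/-- The square is a multiple of a Gaussian with quadratic form `2 S⁻¹`, whose determinant is `2^(2n)
/ det S`. -/
theorem integral_gaussianDensity_sq {S : Matrix (ι ⊕ ι) (ι ⊕ ι) ℝ} (hS : S.PosDef) :
    ∫ z, gaussianDensity S z * gaussianDensity S z =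
      1 / ((4 * Real.pi) ^ Fintype.card ι * Real.sqrt S.det) := by
  have hpd : ((2 : ℝ) • S⁻¹).PosDef := hS.inv.smul two_pos
  have h := (integral_exp_quadraticForm hpd).2
  have e : ∀ z, gaussianDensity S z * gaussianDensity S z =
      (1 / ((2 * Real.pi) ^ Fintype.card ι * Real.sqrt S.det)) ^ 2 *
        Real.exp (-(1 / 2) * (z ⬝ᵥ ((2 : ℝ) • S⁻¹).mulVec z)) := fun z => by
    rw [gaussianDensity, Matrix.smul_mulVec, dotProduct_smul, smul_eq_mul, mul_mul_mul_comm,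
      ← Real.exp_add, sq]
    congr 2
    ring
  have hd := hS.det_pos
  have hpi := Real.pi_pos
  simp only [e]
  rw [integral_const_mul, h, Matrix.det_smul, Matrix.det_nonsing_inv, Ring.inverse_eq_inv',
    Fintype.card_sum, pow_add, pow_add, ← mul_pow (Real.sqrt _), Real.mul_self_sqrt (by positivity),
    Real.sqrt_mul (by positivity), Real.sqrt_mul_self (by positivity), Real.sqrt_inv]
  have hs : 0 < Real.sqrt S.det := Real.sqrt_pos.2 hd
  have h4 : (4 * Real.pi) ^ Fintype.card ι = 2 ^ Fintype.card ι * (2 * Real.pi) ^ Fintype.card ι := by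
    rw [← mul_pow]; congr 1; ring
  rw [h4]
  field_simp

end GaussianDensity

/-! ### Saturated uncertainty and symplectic matrices -/

section Symplectic

set_option linter.unusedSectionVars false

variable {κ : Type} [Fintype κ] [DecidableEq κ]

/-- Testing `1 ± H` on a unit eigenvector gives `1 ± λ ≥ 0`. -/
theorem abs_eigenvalues_le_one {H : Matrix κ κ ℂ} (hH : H.IsHermitian)
    (h1 : (1 + H).PosSemidef) (h2 : (1 - H).PosSemidef) (i : κ) : |hH.eigenvalues i| ≤ 1 := by
  set v : κ → ℂ := ⇑(hH.eigenvectorBasis i) with hv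
  have hHv : H.mulVec v = ((hH.eigenvalues i : ℝ) : ℂ) • v := hH.mulVec_eigenvectorBasis i
  have hvv : star v ⬝ᵥ v = 1 := by
    have := (EuclideanSpace.inner_eq_star_dotProduct (hH.eigenvectorBasis i)
      (hH.eigenvectorBasis i)).symm
    rw [inner_self_eq_norm_sq_to_K, hH.eigenvectorBasis.orthonormal.1 i] at this
    rw [dotProduct_comm]
    simpa using this
  have e1 := h1.re_dotProduct_nonneg v
  have e2 := h2.re_dotProduct_nonneg v
  rw [Matrix.add_mulVec, Matrix.one_mulVec, hHv, dotProduct_add, dotProduct_smul, hvv] at e1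
  rw [Matrix.sub_mulVec, Matrix.one_mulVec, hHv, dotProduct_sub, dotProduct_smul, hvv] at e2
  simp at e1 e2
  exact abs_le.2 ⟨by linarith, by linarith⟩

/-- A Hermitian contraction whose determinant has modulus one squares to the identity. -/
theorem mul_self_eq_one_of_norm_det {H : Matrix κ κ ℂ} (hH : H.IsHermitian)
    (h1 : (1 + H).PosSemidef) (h2 : (1 - H).PosSemidef) (hd : ‖H.det‖ = 1) : H * H = 1 := by
  have hle := abs_eigenvalues_le_one hH h1 h2
  have hprod : ∏ i, |hH.eigenvalues i| = 1 := by
    rw [hH.det_eq_prod_eigenvalues, norm_prod] at hd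
    simpa using hd
  -- A product of factors at most one in modulus can equal one only if every factor has modulus one.
  have habs : ∀ i, |hH.eigenvalues i| = 1 := by
    intro i
    refine le_antisymm (hle i) ?_
    rw [← hprod, ← Finset.mul_prod_erase _ _ (Finset.mem_univ i)]
    exact mul_le_of_le_one_right (abs_nonneg _)
      (Finset.prod_le_one (fun _ _ => abs_nonneg _) fun j _ => hle j)
  have hsq : (Matrix.diagonal (RCLike.ofReal ∘ hH.eigenvalues) : Matrix κ κ ℂ) *
      Matrix.diagonal (RCLike.ofReal ∘ hH.eigenvalues) = 1 := by
    rw [Matrix.diagonal_mul_diagonal, ← Matrix.diagonal_one]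
    congr 1
    ext i
    have := sq_abs (hH.eigenvalues i)
    rw [habs i, one_pow, sq] at this
    simp only [Function.comp_apply]
    rw [← RCLike.ofReal_mul, ← this, RCLike.ofReal_one]
  rw [hH.spectral_theorem, ← map_mul, hsq, map_one]

variable {ι : Type} [Fintype ι] [DecidableEq ι]

theorem stdJ_mul_self (R : Type) [CommRing R] : stdJ ι R * stdJ ι R = -1 := by
  rw [stdJ, Matrix.fromBlocks_multiply]
  simp [← Matrix.fromBlocks_one, Matrix.fromBlocks_neg]

theorem stdJ_transpose (R : Type) [CommRing R] : (stdJ ι R).transpose = -stdJ ι R := by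
  simp [stdJ, Matrix.fromBlocks_transpose, Matrix.fromBlocks_neg]

theorem stdJ_map : (stdJ ι ℝ).map (fun a : ℝ => (a : ℂ)) = stdJ ι ℂ := by
  ext (i | i) (j | j) <;> simp [stdJ, Matrix.one_apply, apply_ite]

theorem det_stdJ_sq : (stdJ ι ℝ).det ^ 2 = 1 := by
  rw [sq, ← Matrix.det_mul, stdJ_mul_self, Matrix.det_neg, Matrix.det_one, mul_one,
    Fintype.card_sum, ← two_mul, pow_mul]
  simp

/-- A positive definite matrix of determinant one with `G + iJ ≥ 0` is of the form `Pᵀ P` with `P`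
symplectic. -/
theorem exists_symplectic_of_det_eq_one {G : Matrix (ι ⊕ ι) (ι ⊕ ι) ℝ} (hG : G.PosDef)
    (hu : (G.map (fun a : ℝ => (a : ℂ)) + Complex.I • stdJ ι ℂ).PosSemidef) (hd : G.det = 1) :
    ∃ S : Matrix (ι ⊕ ι) (ι ⊕ ι) ℝ,
      S.transpose * stdJ ι ℝ * S = stdJ ι ℝ ∧ G = S.transpose * S := by
  obtain ⟨P, hP, hPT, hPG⟩ := hG.exists_sqrt
  have hPu : IsUnit P.det := isUnit_iff_ne_zero.2 hP.det_pos.ne'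
  have hGu : IsUnit G.det := by rw [hd]; exact isUnit_one
  set J := stdJ ι ℝ with hJ
  have hJJ : J * J = -1 := stdJ_mul_self ℝ
  have hJT : J.transpose = -J := stdJ_transpose ℝ
  set K := P⁻¹ * J * P⁻¹ with hK
  have hPiT : (P⁻¹).transpose = P⁻¹ := by rw [Matrix.transpose_nonsing_inv, hPT]
  have hKT : K.transpose = -K := by
    rw [hK, Matrix.transpose_mul, Matrix.transpose_mul, hPiT, hJT, ← Matrix.mul_assoc]
    simp
  let c : Matrix (ι ⊕ ι) (ι ⊕ ι) ℝ →+* Matrix (ι ⊕ ι) (ι ⊕ ι) ℂ := Complex.ofRealHom.mapMatrix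
  have hcm : ∀ M, c M = M.map (fun a : ℝ => (a : ℂ)) := fun M => rfl
  have hct : ∀ M, (c M).conjTranspose = c M.transpose := fun M => by
    ext i j; simp [hcm]
  set H : Matrix (ι ⊕ ι) (ι ⊕ ι) ℂ := Complex.I • c K with hHdef
  have hcJ : c J = stdJ ι ℂ := stdJ_map
  have hH : H.IsHermitian := by
    rw [Matrix.IsHermitian, hHdef, Matrix.conjTranspose_smul, hct, hKT, map_neg]
    simp
  have hone : c (P⁻¹) * c G * c (P⁻¹) = 1 := by
    rw [← map_mul, ← map_mul, ← hPG, ← Matrix.mul_assoc, Matrix.nonsing_inv_mul _ hPu,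
      Matrix.one_mul, Matrix.mul_nonsing_inv _ hPu, map_one]
  -- Congruence of `G + iJ ≥ 0` by `P⁻¹` gives `1 + H ≥ 0`.
  have h1 : (1 + H).PosSemidef := by
    have := hu.mul_mul_conjTranspose_same (c (P⁻¹))
    rw [hct, hPiT, ← hcm, ← hcJ, Matrix.mul_add, Matrix.add_mul, hone, Matrix.mul_smul,
      Matrix.smul_mul, ← map_mul, ← map_mul] at this
    exact this
  -- `K` is antisymmetric, so transposition turns `1 + H` into `1 - H` and preserves positivity.
  have h2 : (1 - H).PosSemidef := by
    have := h1.transpose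
    rw [Matrix.transpose_add, Matrix.transpose_one, hHdef, Matrix.transpose_smul] at this
    have ht : (c K).transpose = c K.transpose := rfl
    rwa [ht, hKT, map_neg, smul_neg, ← sub_eq_add_neg] at this
  have hPd : P.det = 1 := by
    have h3 : P.det ^ 2 = 1 := by rw [sq, ← Matrix.det_mul, hPG, hd]
    exact (pow_eq_one_iff_of_nonneg hP.det_pos.le two_ne_zero).1 h3
  have hHd : ‖H.det‖ = 1 := by
    have hKd : K.det ^ 2 = 1 := by
      rw [hK, Matrix.det_mul, Matrix.det_mul, Matrix.det_nonsing_inv, hPd]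
      simp only [Ring.inverse_one, one_mul, mul_one]
      exact det_stdJ_sq
    have hcd : (c K).det = (K.det : ℂ) := (RingHom.map_det Complex.ofRealHom K).symm
    rw [hHdef, Matrix.det_smul, hcd, norm_mul, norm_pow, Complex.norm_I, one_pow, one_mul,
      Complex.norm_real, Real.norm_eq_abs]
    exact (pow_eq_one_iff_of_nonneg (abs_nonneg _) two_ne_zero).1 (by rw [sq_abs, hKd])
  have hHH := mul_self_eq_one_of_norm_det hH h1 h2 hHd
  have hKK : K * K = -1 := by
    have hinj : Function.Injective c := Matrix.map_injective Complex.ofReal_injective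
    refine hinj ?_
    rw [map_neg, map_one, map_mul, ← hHH, hHdef, Matrix.smul_mul, Matrix.mul_smul, smul_smul,
      Complex.I_mul_I, neg_one_smul, neg_neg]
  have hPP : P * P⁻¹ = 1 := Matrix.mul_nonsing_inv _ hPu
  have hPP' : P⁻¹ * P = 1 := Matrix.nonsing_inv_mul _ hPu
  have hJGJ : J * (P⁻¹ * P⁻¹) * J = -(P * P) := by
    calc J * (P⁻¹ * P⁻¹) * J = (P * P⁻¹) * J * (P⁻¹ * P⁻¹) * J * (P⁻¹ * P) := by
          rw [hPP, hPP', Matrix.one_mul, Matrix.mul_one]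
      _ = P * (K * K) * P := by simp only [hK, Matrix.mul_assoc]
      _ = -(P * P) := by rw [hKK]; simp
  have hinv : (-(J * P * J)) * (-(J * P * J)) = P⁻¹ * P⁻¹ := by
    calc (-(J * P * J)) * (-(J * P * J)) = J * P * (J * J) * P * J := by
          simp only [Matrix.mul_assoc, neg_mul_neg]
      _ = J * (-(P * P)) * J := by rw [hJJ]; simp [Matrix.mul_assoc]
      _ = (J * J) * (P⁻¹ * P⁻¹) * (J * J) := by rw [← hJGJ]; simp only [Matrix.mul_assoc]
      _ = P⁻¹ * P⁻¹ := by rw [hJJ]; simp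
  have hQ : (-(J * P * J)).PosSemidef := by
    have := hP.posSemidef.conjTranspose_mul_mul_same J
    rwa [Matrix.conjTranspose_eq_transpose_of_trivial, hJT, Matrix.neg_mul, Matrix.neg_mul] at this
  -- `-(J P J) = Jᵀ P J` and `P⁻¹` are both positive with square `G⁻¹`, hence equal; this is the
  -- symplectic condition for `P`.
  have hQP := hQ.eq_of_mul_self_eq hP.inv.posSemidef hinv
  refine ⟨P, ?_, by rw [hPT, hPG]⟩
  rw [hPT]
  calc P * J * P = -(J * J) * P * J * P := by rw [hJJ]; simp
    _ = J * (-(J * P * J)) * P := by simp [Matrix.mul_assoc]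
    _ = J := by rw [hQP, Matrix.mul_assoc, hPP', Matrix.mul_one]

/-- Scaling by `2/ħ` normalizes both the uncertainty principle and the determinant. Conversely,
determinants in `Sᵀ J S = J` give `(det S)² = 1`. -/
theorem exists_symplectic_iff {ħ : ℝ} (hħ : 0 < ħ) {M : Matrix (ι ⊕ ι) (ι ⊕ ι) ℝ} (hM : M.PosDef)
    (hu : (M.map (fun a : ℝ => (a : ℂ)) + (Complex.I * (ħ : ℂ) / 2) • stdJ ι ℂ).PosSemidef) :
    M.det = (ħ / 2) ^ (2 * Fintype.card ι) ↔ ∃ S : Matrix (ι ⊕ ι) (ι ⊕ ι) ℝ,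
      S.transpose * stdJ ι ℝ * S = stdJ ι ℝ ∧ M = (ħ / 2) • (S.transpose * S) := by
  have hcard : Fintype.card (ι ⊕ ι) = 2 * Fintype.card ι := by rw [Fintype.card_sum, two_mul]
  have hc : 0 < 2 / ħ := by positivity
  constructor
  · intro hd
    have hG : ((2 / ħ) • M).PosDef := hM.smul hc
    have hGu : ((((2 / ħ) • M).map (fun a : ℝ => (a : ℂ))) +
        Complex.I • stdJ ι ℂ).PosSemidef := by
      have h := hu.smul (a := ((2 / ħ : ℝ) : ℂ)) (by exact_mod_cast hc.le)
      convert h using 1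
      rw [smul_add, smul_smul]
      congr 1
      · ext i j; simp
      · congr 1
        have : (ħ : ℂ) ≠ 0 := by exact_mod_cast hħ.ne'
        push_cast
        field_simp
    obtain ⟨S, hS, hGS⟩ := exists_symplectic_of_det_eq_one hG hGu (by
      rw [Matrix.det_smul, hd, hcard, ← mul_pow]
      rw [show 2 / ħ * (ħ / 2) = 1 by field_simp, one_pow])
    refine ⟨S, hS, ?_⟩
    rw [← hGS, smul_smul, show ħ / 2 * (2 / ħ) = 1 by field_simp, one_smul]
  · rintro ⟨S, hS, rfl⟩
    have h1 := congrArg Matrix.det hS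
    rw [Matrix.det_mul, Matrix.det_mul, Matrix.det_transpose] at h1
    have hJ0 : (stdJ ι ℝ).det ≠ 0 := fun h => by simpa [h] using det_stdJ_sq (ι := ι)
    have h2 : S.det * S.det = 1 := mul_right_cancel₀ hJ0 (by rw [one_mul]; linarith)
    rw [Matrix.det_smul, Matrix.det_mul, Matrix.det_transpose, h2, mul_one, hcard]

end Symplectic

/-! ### Wigner distributions as traces against reflections -/

section WignerTrace

open scoped InnerProduct

variable {ι : Type} [Fintype ι]

/-- The Wigner distribution of a density operator is the expectation of the reflection operators. -/
theorem IsDensityOperator.isWignerDistribution_iff {ħ : ℝ} (hħ : 0 < ħ) {T : L2 ι →L[ℂ] L2 ι}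
    (hT : IsDensityOperator T) (w : (ι ⊕ ι → ℝ) → ℂ) :
    IsWignerDistribution ħ T w ↔ ∀ z, HasTrace (T ∘L royer ħ z)
      ((((Real.pi * ħ) ^ Fintype.card ι : ℝ) : ℂ) * w z) := by
  obtain ⟨S, hS, hHS, rfl⟩ := exists_hilbertSchmidt_sqrt hT.positive hT.traceClass
  have hc : ((((1 / (Real.pi * ħ)) ^ Fintype.card ι : ℝ) : ℂ) *
      (((Real.pi * ħ) ^ Fintype.card ι : ℝ) : ℂ)) = 1 := by
    have := Real.pi_pos
    rw [← Complex.ofReal_mul, ← mul_pow, one_div, inv_mul_cancel₀ (by positivity), one_pow,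
      Complex.ofReal_one]
  have hc' := hc
  rw [mul_comm] at hc'
  constructor
  · intro h z
    -- The series defining the Wigner distribution is the trace of `royer ħ z` times `T`; cyclicity
    -- moves `T` to the left.
    obtain ⟨t, h1, h2, -⟩ := exists_hasTrace_sandwich hS hHS (royer ħ z)
    obtain ⟨v, b, -⟩ := exists_hilbertBasis ℂ (L2 ι)
    have h3 := h _ b z
    simp only [crossWigner_eq_inner hħ] at h3
    rw [h3.unique ((h2 _ b).mul_left _), ← mul_assoc, hc', one_mul]
    exact h1
  · intro h J b z
    obtain ⟨t, h1, h2, -⟩ := exists_hasTrace_sandwich hS hHS (royer ħ z)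
    simp only [crossWigner_eq_inner hħ]
    have h3 := (h2 _ b).mul_left (((1 / (Real.pi * ħ)) ^ Fintype.card ι : ℝ) : ℂ)
    rw [h1.unique (h z), ← mul_assoc, hc, one_mul] at h3
    exact h3

end WignerTrace

/-! ### Covariance of the marginal Gaussian -/

section Marginal

set_option linter.unusedSectionVars false

variable {α β : Type} [Fintype α] [Fintype β] [DecidableEq α] [DecidableEq β]

theorem gaussianDensity_toPositionMomentum_joinPhase
    (M : Matrix ((α ⊕ α) ⊕ (β ⊕ β)) ((α ⊕ α) ⊕ (β ⊕ β)) ℝ) (z : α ⊕ α → ℝ) (w : β ⊕ β → ℝ) :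
    gaussianDensity (toPositionMomentum M) (joinPhase z w) =
      1 / ((2 * Real.pi) ^ Fintype.card (α ⊕ β) * Real.sqrt M.det) *
        Real.exp (-(1 / 2) * (Sum.elim z w ⬝ᵥ M⁻¹.mulVec (Sum.elim z w))) := by
  rw [gaussianDensity, toPositionMomentum, Matrix.det_submatrix_equiv_self,
    Matrix.inv_submatrix_equiv, joinPhase, Matrix.submatrix_mulVec_equiv, Function.comp_assoc,
    Equiv.self_comp_symm, Function.comp_id, comp_equiv_dotProduct_comp_equiv]

theorem posDef_of_toPositionMomentum {M : Matrix ((α ⊕ α) ⊕ (β ⊕ β)) ((α ⊕ α) ⊕ (β ⊕ β)) ℝ}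
    (hM : (toPositionMomentum M).PosDef) : M.PosDef := by
  have := hM.submatrix (Equiv.sumSumSumComm α β α β).symm.injective
  rwa [toPositionMomentum, Matrix.submatrix_submatrix, Equiv.self_comp_symm,
    Matrix.submatrix_id_id] at this

variable {A : Matrix (α ⊕ α) (α ⊕ α) ℝ} {B : Matrix (α ⊕ α) (β ⊕ β) ℝ}
  {D : Matrix (β ⊕ β) (β ⊕ β) ℝ}

theorem posDef_of_toPositionMomentum_fromBlocks
    (hM : (toPositionMomentum (Matrix.fromBlocks A B B.transpose D)).PosDef) : A.PosDef :=
  (posDef_of_toPositionMomentum hM).submatrix (e := Sum.inl) Sum.inl_injective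

/-- A principal submatrix of a positive semidefinite matrix is positive semidefinite, and on the
indices of the first system `J` restricts to `J_A`. -/
theorem uncertainty_of_toPositionMomentum_fromBlocks {ħ : ℝ}
    (hM : ((toPositionMomentum (Matrix.fromBlocks A B B.transpose D)).map (fun a : ℝ => (a : ℂ)) +
      (Complex.I * (ħ : ℂ) / 2) • stdJ (α ⊕ β) ℂ).PosSemidef) :
    (A.map (fun a : ℝ => (a : ℂ)) + (Complex.I * (ħ : ℂ) / 2) • stdJ α ℂ).PosSemidef := by
  convert hM.submatrix (Sum.map Sum.inl Sum.inl : α ⊕ α → (α ⊕ β) ⊕ (α ⊕ β)) using 1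
  ext (i | i) (j | j) <;>
    simp [toPositionMomentum, stdJ, Matrix.one_apply]

/-- The marginal of a centered Gaussian density has the restricted covariance matrix. -/
theorem integral_gaussianDensity_joinPhase
    (hM : (toPositionMomentum (Matrix.fromBlocks A B B.transpose D)).PosDef) (z : α ⊕ α → ℝ) :
    Integrable (fun w => gaussianDensity
      (toPositionMomentum (Matrix.fromBlocks A B B.transpose D)) (joinPhase z w)) ∧
    ∫ w, gaussianDensity (toPositionMomentum (Matrix.fromBlocks A B B.transpose D))
      (joinPhase z w) = gaussianDensity A z := by
  have hS := posDef_of_toPositionMomentum hM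
  have hA := posDef_of_toPositionMomentum_fromBlocks hM
  obtain ⟨hi, hg⟩ := integral_exp_fromBlocks hS z
  simp only [gaussianDensity_toPositionMomentum_joinPhase]
  refine ⟨hi.const_mul _, ?_⟩
  have hpi := Real.pi_pos
  have h1 := Real.sqrt_pos.2 hS.det_pos
  have h2 := Real.sqrt_pos.2 hA.det_pos
  rw [integral_const_mul, hg, gaussianDensity, Fintype.card_sum, Fintype.card_sum, pow_add,
    pow_add, ← mul_pow (Real.sqrt _), Real.mul_self_sqrt (by positivity)]
  field_simp

end Marginal

/-! ### The reduced Gaussian state, its purity, and the main theorem -/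

section ReducedState

open scoped InnerProduct

variable {α β : Type} [Fintype α] [Fintype β] [DecidableEq α] [DecidableEq β]

/-- The reflection at `z` is a test operator for the partial trace, so the Wigner function of `X` is
the marginal Gaussian. The constants match because `(πħ)^(-n_B) (πħ)^(n_A + n_B) = (πħ)^(n_A)`. -/
theorem IsGaussianState.of_isPartialTrace {ħ : ℝ} (hħ : 0 < ħ) {A : Matrix (α ⊕ α) (α ⊕ α) ℝ}
    {B : Matrix (α ⊕ α) (β ⊕ β) ℝ} {D : Matrix (β ⊕ β) (β ⊕ β) ℝ}
    {ρ : L2 (α ⊕ β) →L[ℂ] L2 (α ⊕ β)}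
    (hρ : IsGaussianState ħ ρ (toPositionMomentum (Matrix.fromBlocks A B B.transpose D)))
    {X : L2 α →L[ℂ] L2 α} (hX : IsPartialTrace ρ X) (hXd : IsDensityOperator X) :
    IsGaussianState ħ X A := by
  refine ⟨hXd, posDef_of_toPositionMomentum_fromBlocks hρ.posDef,
    uncertainty_of_toPositionMomentum_fromBlocks hρ.uncertainty,
    (hXd.isWignerDistribution_iff hħ _).2 fun z => ?_⟩
  have hw := (hρ.density.isWignerDistribution_iff hħ _).1 hρ.wigner
  obtain ⟨S, hS, hHS, rfl⟩ :=
    exists_hilbertSchmidt_sqrt hρ.density.positive hρ.density.traceClass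
  obtain ⟨R, hR⟩ := exists_isTensorId_royer (β := β) ħ z
  obtain ⟨hi, hg⟩ := integral_gaussianDensity_joinPhase hρ.posDef z
  obtain ⟨t, h1, h2⟩ := hX.2 _ _ hR
  have h3 := hasTrace_comp_royer_tensorId (F := fun w => _ * ((gaussianDensity _ (joinPhase z w) : ℝ) : ℂ))
    hħ hS hHS z hR (hi.ofReal.const_mul _) fun w => hw (joinPhase z w)
  have hpi := Real.pi_pos
  rw [integral_const_mul, integral_complex_ofReal, hg] at h3
  convert h2 using 1
  rw [h1.unique h3, ← mul_assoc]
  congr 1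
  rw [← Complex.ofReal_mul, Fintype.card_sum, pow_add, one_div, inv_pow]
  congr 1
  field_simp

variable {ħ : ℝ} {M : Matrix (α ⊕ α) (α ⊕ α) ℝ} {T : L2 α →L[ℂ] L2 α}

/-- The purity of a Gaussian state. -/
theorem IsGaussianState.hasTrace_sq (hħ : 0 < ħ) (hT : IsGaussianState ħ T M) :
    HasTrace (T ∘L T)
      (((ħ / 2) ^ Fintype.card α * M.det ^ (-(1 / 2) : ℝ) : ℝ) : ℂ) := by
  have hw := (hT.density.isWignerDistribution_iff hħ _).1 hT.wigner
  obtain ⟨S, hS, hHS, rfl⟩ :=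
    exists_hilbertSchmidt_sqrt hT.density.positive hT.density.traceClass
  have h := _root_.hasTrace_sq (w := fun z => _ * (gaussianDensity M z : ℝ)) hħ hS hHS
    ((gaussianDensity_integrable hT.posDef).ofReal.const_mul _) hw
  convert h using 1
  have hpi := Real.pi_pos
  have h2 := Real.sqrt_pos.2 hT.posDef.det_pos
  simp only [← Complex.ofReal_mul, mul_mul_mul_comm _ (gaussianDensity M _)]
  rw [integral_complex_ofReal, integral_const_mul, integral_gaussianDensity_sq hT.posDef,
    ← Complex.ofReal_mul, Real.rpow_neg hT.posDef.det_pos.le, ← Real.sqrt_eq_rpow]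
  congr 1
  -- Both sides equal `(2πħ)^n`.
  have e : (4 * Real.pi : ℝ) ^ Fintype.card α * ((ħ / 2) ^ Fintype.card α) =
      (2 / (Real.pi * ħ)) ^ Fintype.card α *
        ((Real.pi * ħ) ^ Fintype.card α * (Real.pi * ħ) ^ Fintype.card α) := by
    simp only [← mul_pow]
    congr 1
    field_simp
    norm_num
  rw [← mul_assoc, ← e]
  field_simp

/-- The determinant condition says that the trace of `T²` is one. A pure state satisfies `T² = T`,
and a density operator with this trace equal to one is pure. -/
theorem IsGaussianState.isPureState_iff (hħ : 0 < ħ) (hT : IsGaussianState ħ T M) :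
    IsPureState T ↔ M.det = (ħ / 2) ^ (2 * Fintype.card α) := by
  have hd := hT.posDef.det_pos
  have hs := Real.sqrt_pos.2 hd
  have h := hT.hasTrace_sq hħ
  rw [Real.rpow_neg hd.le, ← Real.sqrt_eq_rpow] at h
  have key : M.det = (ħ / 2) ^ (2 * Fintype.card α) ↔
      (ħ / 2) ^ Fintype.card α * (Real.sqrt M.det)⁻¹ = 1 := by
    rw [mul_inv_eq_one₀ hs.ne', mul_comm 2, pow_mul, eq_comm,
      eq_comm (b := Real.sqrt M.det), Real.sqrt_eq_iff_eq_sq hd.le (by positivity), eq_comm]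
  rw [key]
  constructor
  · intro hp
    rw [hp.comp_self] at h
    exact_mod_cast h.unique hT.density.trace_one
  · intro h1
    rw [h1, Complex.ofReal_one] at h
    exact hT.density.isPureState h

end ReducedState

theorem mainTheorem3 (nA nB : ℕ) (ħ : ℝ) (hħ : 0 < ħ)
    (SAA : Matrix (Fin nA ⊕ Fin nA) (Fin nA ⊕ Fin nA) ℝ)
    (SAB : Matrix (Fin nA ⊕ Fin nA) (Fin nB ⊕ Fin nB) ℝ)
    (SBB : Matrix (Fin nB ⊕ Fin nB) (Fin nB ⊕ Fin nB) ℝ)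
    (ρ : L2 (Fin nA ⊕ Fin nB) →L[ℂ] L2 (Fin nA ⊕ Fin nB))
    (hρ : IsGaussianState ħ ρ
      (toPositionMomentum (Matrix.fromBlocks SAA SAB SAB.transpose SBB))) :
    (∃! ρA : L2 (Fin nA) →L[ℂ] L2 (Fin nA), IsPartialTrace ρ ρA) ∧
    ∀ ρA : L2 (Fin nA) →L[ℂ] L2 (Fin nA), IsPartialTrace ρ ρA →
      IsGaussianState ħ ρA SAA ∧
      HasTrace (ρA ∘L ρA) (((ħ / 2) ^ nA * SAA.det ^ (-(1 / 2) : ℝ) : ℝ) : ℂ) ∧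
      (IsPureState ρA ↔ SAA.det = (ħ / 2) ^ (2 * nA)) ∧
      (IsPureState ρA ↔ ∃ S : Matrix (Fin nA ⊕ Fin nA) (Fin nA ⊕ Fin nA) ℝ,
        S.transpose * stdJ (Fin nA) ℝ * S = stdJ (Fin nA) ℝ ∧
          SAA = (ħ / 2) • (S.transpose * S)) := by
  obtain ⟨X, hX, hXd⟩ := exists_isPartialTrace hρ.density
  refine ⟨⟨X, hX, fun Y hY => hY.unique hX⟩, fun ρA hA => ?_⟩
  obtain rfl := hA.unique hX
  have hG := hρ.of_isPartialTrace hħ hX hXd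
  have hp := hG.isPureState_iff hħ
  have hs := exists_symplectic_iff hħ hG.posDef hG.uncertainty
  have ht := hG.hasTrace_sq hħ
  rw [Fintype.card_fin] at hp hs ht
  exact ⟨hG, ht, hp, hp.trans hs⟩
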